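/- Let $n\ge 1$ and let the symmetric group $S_n$ act on $C_2^n=\{0,1\}^n$ by permuting coordinates. For $x\in C_2^n$ let $G_x\le S_n$ be the stabilizer of $x$ and $\mathcal O_x$ its orbit, and for $\sigma\in S_n$ let $\mathfrak X_\sigma\subseteq C_2^n$ be the set of tuples fixed by $\sigma$. The binary Burnside process is the Markov chain on $C_2^n$ with transition matrix $$K(x,y)=\frac1{|G_x|}\sum_{\sigma\in G_x\cap G_y}\frac1{|\mathfrak X_\sigma|},$$ and its stationary distribution is $\pi(x)=\frac{1}{Z\,|\mathcal O_x|}$, where $Z=n+1$ is the number of orbits. For a starting state $x$ and a number of steps $s\ge 0$ put $$\chi_x^2(s)=\sum_{y}\frac{(K^s(x,y)-\pi(y))^2}{\pi(y)},\qquad \|K_x^s-\pi\|_{\mathrm{TV}}=\frac12\sum_y|K^s(x,y)-\pi(y)|.$$ **Theorem.** For all $n,s\ge 3$ and every state $x\in C_2^n$ with exactly one coordinate equal to $1$ (in particular for $e_n=(0,\dots,0,1)$), $$5\left(\tfrac14\right)^{2s}\le \chi_x^2(s)\le 270\left(\tfrac14\right)^{2s}.$$ Moreover, from such states a constant number of steps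 is necessary and sufficient in $\ell^2$ and in $\ell^1$. That is, for every $\varepsilon>0$ there is $s_0$, not depending on $n$, such that $\chi_x^2(s)\le\varepsilon$ and $\|K_x^s-\pi\|_{\mathrm{TV}}\le\varepsilon$ for all $n\ge 3$, all $x\in C_2^n$ with exactly one $1$ and all $s\ge s_0$; and for every $s_0$ there is $\varepsilon>0$, not depending on $n$, such that $\chi_x^2(s)\ge\varepsilon$ and $\|K_x^s-\pi\|_{\mathrm{TV}}\ge\varepsilon$ for all $n\ge 3$, all such $x$ and all $s\le s_0$. -/

import Mathlib

noncomputable section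

/-- The transition matrix of the Burnside process of a finite group `G` acting on a finite set `X`:
`K(x, y) = |G_x|⁻¹ * ∑_{g ∈ G_x ∩ G_y} |X_g|⁻¹`, where `G_x` is the stabilizer of `x` and `X_g` is
the set of points fixed by `g`. -/
def burnsideKernel (G X : Type*) [Group G] [Fintype G] [MulAction G X] [DecidableEq X] :
    Matrix X X ℝ :=
  Matrix.of fun x y =>
    (Nat.card (MulAction.stabilizer G x) : ℝ)⁻¹ *
      ∑ g : G with g • x = x ∧ g • y = y, (Nat.card (MulAction.fixedBy X g) : ℝ)⁻¹

/-- The stationary distribution of the Burnside process: `π(x) = 1 / (Z * |O_x|)`, where `Z` is the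
number of orbits and `O_x` is the orbit of `x`. -/
def burnsideStationary (G X : Type*) [Group G] [MulAction G X] (x : X) : ℝ :=
  1 / ((Nat.card (MulAction.orbitRel.Quotient G X) : ℝ) * (Nat.card (MulAction.orbit G x) : ℝ))

/-- The chi-square distance between `π` and the law after `s` steps of the chain with transition
matrix `K` started at `x`. -/
def chiSquareDist {X : Type*} [Fintype X] [DecidableEq X] (K : Matrix X X ℝ) (π : X → ℝ)
    (x : X) (s : ℕ) : ℝ :=
  ∑ y, ((K ^ s) x y - π y) ^ 2 / π y

/-- The total variation distance between `π` and the law after `s` steps of the chain with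
transition matrix `K` started at `x`. -/
def totalVariationDist {X : Type*} [Fintype X] [DecidableEq X] (K : Matrix X X ℝ) (π : X → ℝ)
    (x : X) (s : ℕ) : ℝ :=
  1 / 2 * ∑ y, |(K ^ s) x y - π y|

/-- The symmetric group acts on binary `n`-tuples by permuting coordinates. -/
instance binaryTupleAction (n : ℕ) : MulAction (Equiv.Perm (Fin n)) (Fin n → ZMod 2) where
  smul σ x := fun i => x (σ⁻¹ i)
  one_smul _ := rfl
  mul_smul σ τ x := by
    funext i
    change x ((σ * τ)⁻¹ i) = x (τ⁻¹ (σ⁻¹ i))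
    rw [mul_inv_rev, Equiv.Perm.mul_apply]

/-- The transition matrix of the binary Burnside process on `C_2^n`. -/
def binaryBurnside (n : ℕ) : Matrix (Fin n → ZMod 2) (Fin n → ZMod 2) ℝ :=
  burnsideKernel (Equiv.Perm (Fin n)) (Fin n → ZMod 2)

/-- The stationary distribution of the binary Burnside process on `C_2^n`. -/
def binaryStationary (n : ℕ) : (Fin n → ZMod 2) → ℝ :=
  burnsideStationary (Equiv.Perm (Fin n)) (Fin n → ZMod 2)

/-- The chi-square distance to stationarity of the binary Burnside process after `s` steps,
started at `x`. -/
def binaryChiSquare (n : ℕ) (x : Fin n → ZMod 2) (s : ℕ) : ℝ :=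
  chiSquareDist (binaryBurnside n) (binaryStationary n) x s

/-- The total variation distance to stationarity of the binary Burnside process after `s` steps,
started at `x`. -/
def binaryTV (n : ℕ) (x : Fin n → ZMod 2) (s : ℕ) : ℝ :=
  totalVariationDist (binaryBurnside n) (binaryStationary n) x s

/-- The state whose only `1` is at coordinate `i`. -/
def singleOne {n : ℕ} (i : Fin n) : Fin n → ZMod 2 :=
  Pi.single i 1

end

open Finset
open Polynomial TensorProduct

/-! The number of tuples fixed by a permutation is 2 to the number of its cycles, so every average
over stabilizers here is a sum of θ^cycles over permutations preserving a coloring. Building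
permutations one point at a time evaluates such a sum as a product of rising factorials
(`sum_perm_fixing`). This makes the kernel and π explicit.

The rising factorials of 1/2 are moments of the arcsine law: a step from x draws two independent
arcsine biases, one for each bit value, and resamples the coordinates where x takes that value with
that bias (`binaryBurnside_eq_arcsineFunctional₂`). Applied to a character of degree m, the kernel
gives a combination of characters on subsets, whose top coefficient is the m-th moment of half the
difference of the biases. So the kernel is triangular along the degree filtration, with diagonal
entries 0 for odd m and (C(2k,k)/4^k)^2 for m = 2k. The largest entry below 1 is 1/4.

By reversibility the kernel is symmetric in L²(π), hence scalar on each orthogonal increment of the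
filtration (`norm_sq_pow_sub_le`). The chi-square distance is then bounded by eigenvalue powers
times a bound on point evaluation in each degree. At a state with a single 1 that bound is free of n
(`sq_apply_singleOne_le`): π is a uniform mixture of Bernoulli product laws, and conditioning on the
1 turns a function of degree m into a polynomial in p of degree at most m, evaluated at 0. The
Christoffel function of the weight p on [0, 1] controls this by a quartic in m. For s ≥ 3 the sum
over m converges and the eigenvalue 1/4 gives the rate.

The lower bounds test against explicit quadratic eigenfunctions of eigenvalue 1/4. -/

/-! ### Cycle-weighted sums over permutations preserving a coloring -/

/-- The rising factorial `θ (θ + 1) ⋯ (θ + m - 1)`. -/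
noncomputable def rising (θ : ℝ) (m : ℕ) : ℝ := ∏ j ∈ range m, (θ + j)

theorem rising_zero (θ : ℝ) : rising θ 0 = 1 := by simp [rising]

theorem rising_succ (θ : ℝ) (m : ℕ) : rising θ (m + 1) = rising θ m * (θ + m) := by
  simp [rising, prod_range_succ]

theorem rising_one (m : ℕ) : rising 1 m = m.factorial := by
  induction m with
  | zero => simp [rising_zero]
  | succ m ih => rw [rising_succ, ih, Nat.factorial_succ]; push_cast; ring

/-- The number of coordinates at which a coloring takes a given value. -/
def colorCount {n : ℕ} {γ : Type*} [DecidableEq γ] (c : Fin n → γ) (g : γ) : ℕ :=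
  #{i | c i = g}

theorem colorCount_zero {γ : Type*} [DecidableEq γ] (c : Fin 0 → γ) (g : γ) :
    colorCount c g = 0 := by
  simp [colorCount]

theorem colorCount_succ {n : ℕ} {γ : Type*} [DecidableEq γ] (c : Fin (n + 1) → γ) (g : γ) :
    colorCount c g = colorCount (Fin.tail c) g + if g = c 0 then 1 else 0 := by
  rw [colorCount, colorCount, card_filter, card_filter, Fin.sum_univ_succ, add_comm]
  simp only [eq_comm (a := g), Fin.tail]
  congr!

/-- The permutation attached to (p, τ) inserts the point 0 into the cycle of p, or makes it a new
cycle when p = 0. Colors stay constant on cycles exactly when τ already respects them and 0 joins a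
cycle of its own color. -/
theorem decomposeFin_symm_fixes_iff {n : ℕ} {γ : Type*} (c : Fin (n + 1) → γ) (p : Fin (n + 1))
    (τ : Equiv.Perm (Fin n)) :
    (∀ i, c (Equiv.Perm.decomposeFin.symm (p, τ) i) = c i) ↔
      c p = c 0 ∧ ∀ i, Fin.tail c (τ i) = Fin.tail c i := by
  rw [Fin.forall_fin_succ]
  simp only [Equiv.Perm.decomposeFin_symm_apply_zero, Equiv.Perm.decomposeFin_symm_apply_succ,
    Fin.tail]
  refine and_congr_right fun h => forall_congr' fun i => ?_
  suffices c (Equiv.swap 0 p (τ i).succ) = c (τ i).succ by rw [this]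
  by_cases hp : (τ i).succ = p
  · rw [hp, Equiv.swap_apply_right, h]
  · rw [Equiv.swap_apply_of_ne_of_ne (Fin.succ_ne_zero _) hp]

/-- The hypotheses on ω characterize θ^cycles: only p = 0 opens a new cycle. In the induction the
new point has weight θ for a new cycle and weight 1 for each earlier point of its color, which is
the next factor of the rising factorial. The values θ = 1, 1/2 and 2 give stabilizers, the kernel
and the number of orbits. -/
theorem sum_perm_fixing (ω : ∀ n, Equiv.Perm (Fin n) → ℝ) (θ : ℝ) (h0 : ω 0 1 = 1)
    (hω : ∀ n p (τ : Equiv.Perm (Fin n)),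
      ω (n + 1) (Equiv.Perm.decomposeFin.symm (p, τ)) = (if p = 0 then θ else 1) * ω n τ)
    {γ : Type*} [Fintype γ] [DecidableEq γ] {n : ℕ} (c : Fin n → γ) :
    ∑ σ with ∀ i, c (σ i) = c i, ω n σ = ∏ g, rising θ (colorCount c g) := by
  induction n with
  | zero =>
    simp only [colorCount_zero, rising_zero, prod_const_one]
    rw [filter_true_of_mem (by simp)]
    simpa using h0
  | succ n ih =>
    have hR : ∏ g, rising θ (colorCount c g) =
        (θ + colorCount (Fin.tail c) (c 0)) * ∏ g, rising θ (colorCount (Fin.tail c) g) := by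
      rw [← mul_prod_erase univ _ (mem_univ (c 0)),
        ← mul_prod_erase univ (fun g => rising θ (colorCount (Fin.tail c) g)) (mem_univ (c 0)),
        colorCount_succ, if_pos rfl, rising_succ]
      rw [prod_congr rfl (g := fun g => rising θ (colorCount (Fin.tail c) g))]
      · ring
      · intro g hg
        rw [colorCount_succ, if_neg (ne_of_mem_erase hg), add_zero]
    rw [hR, ← ih, sum_filter, ← Equiv.sum_comp Equiv.Perm.decomposeFin.symm, Fintype.sum_prod_type]
    simp only [decomposeFin_symm_fixes_iff, hω]
    rw [sum_filter]
    have : ∀ p : Fin (n + 1), (∑ τ : Equiv.Perm (Fin n),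
        if c p = c 0 ∧ ∀ i, Fin.tail c (τ i) = Fin.tail c i then
          (if p = 0 then θ else 1) * ω n τ else 0) =
        (if c p = c 0 then (if p = 0 then θ else 1) else 0) *
          ∑ τ : Equiv.Perm (Fin n), if ∀ i, Fin.tail c (τ i) = Fin.tail c i then ω n τ else 0 := by
      intro p
      rw [mul_sum]
      refine sum_congr rfl fun τ _ => ?_
      split_ifs <;> simp_all
    rw [sum_congr rfl fun p _ => this p, ← sum_mul, Fin.sum_univ_succ]
    simp only [if_true, Fin.succ_ne_zero, if_false, colorCount, Fin.tail, sum_boole]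
    congr!

/-! ### Explicit kernel, stationary law and reversibility -/

/-- The number of binary tuples that are constant on the cycles of a permutation. -/
noncomputable def fixCount (n : ℕ) (σ : Equiv.Perm (Fin n)) : ℕ :=
  Nat.card {y : Fin n → ZMod 2 // ∀ i, y (σ i) = y i}

theorem fixCount_decomposeFin {n : ℕ} (p : Fin (n + 1)) (τ : Equiv.Perm (Fin n)) :
    fixCount (n + 1) (Equiv.Perm.decomposeFin.symm (p, τ)) =
      (if p = 0 then 2 else 1) * fixCount n τ := by
  unfold fixCount
  split_ifs with hp
  · have e : {y : Fin (n + 1) → ZMod 2 // ∀ i, y (Equiv.Perm.decomposeFin.symm (p, τ) i) = y i} ≃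
        ZMod 2 × {y : Fin n → ZMod 2 // ∀ i, y (τ i) = y i} :=
      { toFun := fun y => (y.1 0, ⟨Fin.tail y.1, ((decomposeFin_symm_fixes_iff _ _ _).1 y.2).2⟩)
        invFun := fun z => ⟨Fin.cons z.1 z.2.1, by
          rw [decomposeFin_symm_fixes_iff, hp]
          exact ⟨rfl, by simpa using z.2.2⟩⟩
        left_inv := fun y => by ext1; simp
        right_inv := fun z => by simp }
    rw [Nat.card_congr e, Nat.card_prod]
    simp
  · obtain ⟨q, rfl⟩ := Fin.exists_succ_eq.2 hp
    have e : {y : Fin (n + 1) → ZMod 2 //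
          ∀ i, y (Equiv.Perm.decomposeFin.symm (q.succ, τ) i) = y i} ≃
        {y : Fin n → ZMod 2 // ∀ i, y (τ i) = y i} :=
      { toFun := fun y => ⟨Fin.tail y.1, ((decomposeFin_symm_fixes_iff _ _ _).1 y.2).2⟩
        invFun := fun z => ⟨Fin.cons (z.1 q) z.1, by
          rw [decomposeFin_symm_fixes_iff]
          exact ⟨by simp, by simpa using z.2⟩⟩
        left_inv := fun y => by
          ext1
          have := ((decomposeFin_symm_fixes_iff _ _ _).1 y.2).1
          change Fin.cons (y.1 q.succ) (Fin.tail y.1) = y.1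
          rw [this]
          simp
        right_inv := fun z => by simp }
    rw [Nat.card_congr e, one_mul]

theorem fixCount_zero : fixCount 0 1 = 1 := by
  simp [fixCount]

theorem perm_smul_eq_iff {n : ℕ} (σ : Equiv.Perm (Fin n)) (x : Fin n → ZMod 2) :
    σ • x = x ↔ ∀ i, x (σ i) = x i := by
  rw [funext_iff, ← σ.forall_congr_right]
  refine forall_congr' fun i => ?_
  change x (σ⁻¹ (σ i)) = x (σ i) ↔ _
  rw [show σ⁻¹ (σ i) = i from σ.symm_apply_apply i, eq_comm]

theorem card_fixedBy_perm {n : ℕ} (σ : Equiv.Perm (Fin n)) :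
    Nat.card (MulAction.fixedBy (Fin n → ZMod 2) σ) = fixCount n σ :=
  Nat.card_congr (Equiv.subtypeEquivRight fun y => perm_smul_eq_iff σ y)

theorem card_stabilizer_perm {n : ℕ} (x : Fin n → ZMod 2) :
    (Nat.card (MulAction.stabilizer (Equiv.Perm (Fin n)) x) : ℝ) =
      ∏ g, ((colorCount x g).factorial : ℝ) := by
  have h := sum_perm_fixing (fun _ _ => 1) 1 rfl (by simp) x
  simp only [rising_one] at h
  rw [← h, sum_const, nsmul_eq_mul, mul_one, ← Fintype.card_subtype, Nat.card_eq_fintype_card.symm]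
  congr 1
  exact Nat.card_congr (Equiv.subtypeEquivRight fun σ => perm_smul_eq_iff σ x)

theorem binaryBurnside_apply {n : ℕ} (x y : Fin n → ZMod 2) :
    binaryBurnside n x y = (∏ g, ((colorCount x g).factorial : ℝ))⁻¹ *
      ∏ g : ZMod 2 × ZMod 2, rising (1 / 2) (colorCount (fun i => (x i, y i)) g) := by
  rw [← sum_perm_fixing (fun n σ => (fixCount n σ : ℝ)⁻¹) (1 / 2) (by simp [fixCount_zero])]
  · simp only [binaryBurnside, burnsideKernel, Matrix.of_apply, card_stabilizer_perm,
      card_fixedBy_perm]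
    congr 2
    ext σ
    simp only [mem_filter, mem_univ, true_and, Prod.mk.injEq, perm_smul_eq_iff, forall_and]
  · intro n p τ
    rw [fixCount_decomposeFin]
    split_ifs <;> simp [mul_comm]

theorem card_orbits_perm (n : ℕ) :
    Nat.card (MulAction.orbitRel.Quotient (Equiv.Perm (Fin n)) (Fin n → ZMod 2)) = n + 1 := by
  classical
  have h := sum_perm_fixing (fun n σ => (fixCount n σ : ℝ)) 2 (by simp [fixCount_zero])
    (by intro n p τ; rw [fixCount_decomposeFin]; split_ifs <;> simp) (fun _ : Fin n => ())
  -- Burnside's lemma with θ = 2: the fixed points sum to (n + 1)!, and division by n! leaves n + 1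
  -- orbits.
  have hr : ∀ n : ℕ, rising 2 n = (n + 1).factorial := by
    intro n
    induction n with
    | zero => simp [rising_zero]
    | succ n ih => rw [rising_succ, ih, Nat.factorial_succ (n + 1)]; push_cast; ring
  have hc : colorCount (fun _ : Fin n => ()) () = n := by simp [colorCount]
  simp only [implies_true, filter_true, univ_unique, prod_singleton, PUnit.default_eq_unit, hc,
    hr] at h
  have h2 := MulAction.sum_card_fixedBy_eq_card_orbits_mul_card_group (Equiv.Perm (Fin n))
    (Fin n → ZMod 2)
  simp only [← Nat.card_eq_fintype_card, card_fixedBy_perm] at h2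
  have h3 : ((n + 1).factorial : ℕ) = Nat.card
      (MulAction.orbitRel.Quotient (Equiv.Perm (Fin n)) (Fin n → ZMod 2)) * n.factorial := by
    rw [Nat.card_eq_fintype_card (α := Equiv.Perm (Fin n)), Fintype.card_perm, Fintype.card_fin]
      at h2
    have h4 : ((∑ σ : Equiv.Perm (Fin n), fixCount n σ : ℕ) : ℝ) = ((n + 1).factorial : ℕ) := by
      push_cast
      exact h
    rw [← Nat.cast_injective h4]
    exact h2
  rw [Nat.factorial_succ] at h3
  exact (Nat.eq_of_mul_eq_mul_right (Nat.factorial_pos n) h3).symm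

theorem binaryStationary_apply {n : ℕ} (x : Fin n → ZMod 2) :
    binaryStationary n x = (∏ g, ((colorCount x g).factorial : ℝ)) / (n + 1).factorial := by
  classical
  have h := MulAction.card_orbit_mul_card_stabilizer_eq_card_group (Equiv.Perm (Fin n)) x
  rw [Fintype.card_perm, Fintype.card_fin] at h
  simp only [← Nat.card_eq_fintype_card] at h
  have h' : (Nat.card (MulAction.orbit (Equiv.Perm (Fin n)) x) : ℝ) *
      ∏ g, ((colorCount x g).factorial : ℝ) = n.factorial := by
    rw [← card_stabilizer_perm]; exact_mod_cast h
  have hne : (Nat.card (MulAction.orbit (Equiv.Perm (Fin n)) x) : ℝ) ≠ 0 := by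
    intro h0
    rw [h0, zero_mul] at h'
    exact Nat.factorial_ne_zero n (by exact_mod_cast h'.symm)
  rw [binaryStationary, burnsideStationary, card_orbits_perm, Nat.factorial_succ]
  push_cast
  rw [← h']
  have hp : (∏ g, ((colorCount x g).factorial : ℝ)) ≠ 0 :=
    prod_ne_zero_iff.2 fun g _ => by positivity
  field_simp

theorem binaryStationary_pos {n : ℕ} (x : Fin n → ZMod 2) : 0 < binaryStationary n x := by
  rw [binaryStationary_apply]
  have : 0 < ∏ g, ((colorCount x g).factorial : ℝ) := prod_pos fun g _ => by positivity
  positivity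

theorem binaryBurnside_reversible {n : ℕ} (x y : Fin n → ZMod 2) :
    binaryStationary n x * binaryBurnside n x y = binaryStationary n y * binaryBurnside n y x := by
  have hp : ∀ x : Fin n → ZMod 2, (∏ g, ((colorCount x g).factorial : ℝ)) ≠ 0 :=
    fun x => prod_ne_zero_iff.2 fun g _ => by positivity
  rw [binaryStationary_apply, binaryStationary_apply, binaryBurnside_apply, binaryBurnside_apply,
    div_mul_eq_mul_div, div_mul_eq_mul_div, mul_inv_cancel_left₀ (hp x),
    mul_inv_cancel_left₀ (hp y), ← Equiv.prod_comp (Equiv.prodComm _ _)]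
  congr 1
  refine prod_congr rfl fun g _ => ?_
  have : colorCount (fun i => (x i, y i)) (Equiv.prodComm _ _ g) =
      colorCount (fun i => (y i, x i)) g := by
    unfold colorCount
    congr 1
    ext i
    simp [Prod.ext_iff, and_comm]
  rw [this]

/-! ### Arcsine moments -/

/-- The moments of the arcsine distribution on `[-1, 1]`. -/
noncomputable def arcsineMoment (m : ℕ) : ℝ :=
  if Even m then (m / 2).centralBinom / 4 ^ (m / 2) else 0

theorem arcsineMoment_two_mul (k : ℕ) : arcsineMoment (2 * k) = k.centralBinom / 4 ^ k := by
  simp [arcsineMoment]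

theorem arcsineMoment_odd {m : ℕ} (hm : Odd m) : arcsineMoment m = 0 := by
  simp [arcsineMoment, Nat.not_even_iff_odd.2 hm]

theorem arcsineMoment_add_two (m : ℕ) :
    (m + 2) * arcsineMoment (m + 2) = (m + 1) * arcsineMoment m := by
  rcases Nat.even_or_odd' m with ⟨k, rfl | rfl⟩
  · rw [show 2 * k + 2 = 2 * (k + 1) by ring, arcsineMoment_two_mul, arcsineMoment_two_mul]
    have h := Nat.succ_mul_centralBinom_succ k
    have h' : ((k : ℝ) + 1) * (k + 1).centralBinom = 2 * (2 * k + 1) * k.centralBinom := by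
      exact_mod_cast h
    rw [pow_succ]
    push_cast
    field_simp
    linear_combination 2 * h'
  · rw [arcsineMoment_odd ⟨k, rfl⟩, arcsineMoment_odd (m := 2 * k + 1 + 2) ⟨k + 1, by ring⟩]
    simp

/-- Integration against the arcsine distribution on `[-1, 1]`, as a functional on polynomials. -/
noncomputable def arcsineFunctional : ℝ[X] →ₗ[ℝ] ℝ :=
  (Polynomial.basisMonomials ℝ).constr ℝ arcsineMoment

theorem arcsineFunctional_X_pow (m : ℕ) : arcsineFunctional (X ^ m) = arcsineMoment m := by
  rw [arcsineFunctional, ← (Polynomial.basisMonomials ℝ).constr_basis ℝ arcsineMoment m,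
    Polynomial.coe_basisMonomials, Polynomial.X_pow_eq_monomial]

/-- Integration by parts against the density proportional to (1 - u²)^(-1/2). On monomials it is the
two-term recursion for the moments. -/
theorem arcsineFunctional_by_parts (F : ℝ[X]) :
    arcsineFunctional ((1 - X ^ 2) * derivative F) = arcsineFunctional (X * F) := by
  induction F using Polynomial.induction_on' with
  | add p q hp hq => simp only [mul_add, map_add, hp, hq]
  | monomial m a =>
    rw [← C_mul_X_pow_eq_monomial, ← smul_eq_C_mul, derivative_smul, mul_smul_comm, mul_smul_comm,
      map_smul, map_smul]
    congr 1
    rw [derivative_X_pow]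
    rcases m with _ | m
    · have h := arcsineMoment_odd (m := 1) (by decide)
      rw [← arcsineFunctional_X_pow] at h
      simpa using h.symm
    · rw [show ((1 - X ^ 2) * (C ((m + 1 : ℕ) : ℝ) * X ^ (m + 1 - 1)) : ℝ[X]) =
        ((m + 1 : ℕ) : ℝ) • (X ^ m - X ^ (m + 2)) by
          rw [smul_eq_C_mul, Nat.add_sub_cancel]; ring,
        ← pow_succ', map_smul, map_sub, arcsineFunctional_X_pow, arcsineFunctional_X_pow,
        smul_eq_mul]
      have := arcsineMoment_add_two m
      push_cast
      linear_combination -this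

/-- The probability of each value of a bit, as a polynomial in its bias `X`. -/
noncomputable def bitPoly (h : ZMod 2) : ℝ[X] := C (1 / 2) * (if h = 0 then 1 + X else 1 - X)

theorem bitPoly_sum : bitPoly 0 + bitPoly 1 = 1 := by
  simp only [bitPoly, if_true, one_ne_zero, if_false]
  rw [← mul_add, show (1 + X + (1 - X) : ℝ[X]) = C 2 by rw [C_ofNat]; ring, ← C_mul]
  norm_num

theorem bitPoly_sub : bitPoly 0 - bitPoly 1 = X := by
  simp only [bitPoly, if_true, one_ne_zero, if_false]
  rw [← mul_sub, show (1 + X - (1 - X) : ℝ[X]) = C 2 * X by rw [C_ofNat]; ring, ← mul_assoc,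
    ← C_mul]
  norm_num

theorem bitPoly_mul : (1 - X ^ 2 : ℝ[X]) = 4 * (bitPoly 0 * bitPoly 1) := by
  rw [← bitPoly_sub]
  linear_combination -(1 + (bitPoly 0 + bitPoly 1)) * bitPoly_sum

theorem derivative_bitPoly (h : ZMod 2) :
    derivative (bitPoly h) = C (if h = 0 then 1 / 2 else -1 / 2) := by
  unfold bitPoly
  split_ifs <;> simp [derivative_mul, neg_div]

/-- Integration by parts applied to a product of powers of the two bit probabilities, using 1 - X² =
4 q₀ q₁ and X = q₀ - q₁. Together with q₀ + q₁ = 1 this determines all the mixed moments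
recursively. -/
theorem arcsineFunctional_bitPoly_ratio (a b : ℕ) :
    (2 * a + 1) * arcsineFunctional (bitPoly 0 ^ (b + 1) * bitPoly 1 ^ a) =
      (2 * b + 1) * arcsineFunctional (bitPoly 0 ^ b * bitPoly 1 ^ (a + 1)) := by
  have h := arcsineFunctional_by_parts (bitPoly 0 ^ b * bitPoly 1 ^ a)
  have hpow : ∀ (P : ℝ[X]) (m : ℕ), P * (C (m : ℝ) * P ^ (m - 1)) = C (m : ℝ) * P ^ m := by
    intro P m
    rcases m with _ | m
    · simp
    · rw [Nat.add_sub_cancel, pow_succ]; ring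
  have e1 : (1 - X ^ 2) * derivative (bitPoly 0 ^ b * bitPoly 1 ^ a) =
      (2 * b : ℝ) • (bitPoly 0 ^ b * bitPoly 1 ^ (a + 1)) -
        (2 * a : ℝ) • (bitPoly 0 ^ (b + 1) * bitPoly 1 ^ a) := by
    rw [derivative_mul, derivative_pow, derivative_pow, derivative_bitPoly, derivative_bitPoly,
      if_pos rfl, if_neg one_ne_zero, bitPoly_mul]
    have h1 := hpow (bitPoly 0) b
    have h2 := hpow (bitPoly 1) a
    have c1 : (C (1 / 2) : ℝ[X]) * 4 = C 2 := by
      rw [← C_ofNat, ← C_mul]; norm_num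
    have c2 : (C (-1 / 2) : ℝ[X]) * 4 = -C 2 := by
      rw [← C_ofNat, ← C_mul, ← C_neg]; norm_num
    rw [smul_eq_C_mul, smul_eq_C_mul, C_mul, C_mul]
    linear_combination 4 * bitPoly 1 ^ (a + 1) * C (1 / 2) * h1 +
      4 * bitPoly 0 ^ (b + 1) * C (-1 / 2) * h2 +
      C (b : ℝ) * bitPoly 0 ^ b * bitPoly 1 ^ (a + 1) * c1 +
      C (a : ℝ) * bitPoly 0 ^ (b + 1) * bitPoly 1 ^ a * c2
  have e2 : X * (bitPoly 0 ^ b * bitPoly 1 ^ a) =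
      bitPoly 0 ^ (b + 1) * bitPoly 1 ^ a - bitPoly 0 ^ b * bitPoly 1 ^ (a + 1) := by
    rw [← bitPoly_sub]; ring
  rw [e1, e2, map_sub, map_sub, map_smul, map_smul, smul_eq_mul, smul_eq_mul] at h
  linear_combination -h

theorem arcsineFunctional_bitPoly_split (a b : ℕ) :
    arcsineFunctional (bitPoly 0 ^ (b + 1) * bitPoly 1 ^ a) +
      arcsineFunctional (bitPoly 0 ^ b * bitPoly 1 ^ (a + 1)) =
      arcsineFunctional (bitPoly 0 ^ b * bitPoly 1 ^ a) := by
  rw [← map_add]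
  congr 1
  linear_combination (bitPoly 0 ^ b * bitPoly 1 ^ a) * bitPoly_sum

theorem arcsineFunctional_bitPoly (a b : ℕ) :
    arcsineFunctional (bitPoly 0 ^ b * bitPoly 1 ^ a) =
      rising (1 / 2) b * rising (1 / 2) a / (b + a).factorial := by
  induction a with
  | zero =>
    induction b with
    | zero =>
      have := arcsineFunctional_X_pow 0
      simpa [rising_zero, arcsineMoment] using this
    | succ b ih =>
      have h1 := arcsineFunctional_bitPoly_ratio 0 b
      have h2 := arcsineFunctional_bitPoly_split 0 b
      rw [show b + 1 + 0 = (b + 0) + 1 by ring, rising_succ, Nat.factorial_succ]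
      rw [eq_div_iff (by positivity)] at ih ⊢
      push_cast at h1 ih ⊢
      linear_combination (b + 1 / 2 : ℝ) * ih +
        (b + 1 / 2 : ℝ) * ((b + 0).factorial : ℝ) * h2 + 1 / 2 * ((b + 0).factorial : ℝ) * h1
  | succ a ih =>
    have h1 := arcsineFunctional_bitPoly_ratio a b
    have h2 := arcsineFunctional_bitPoly_split a b
    rw [show b + (a + 1) = (b + a) + 1 by ring, rising_succ, Nat.factorial_succ]
    rw [eq_div_iff (by positivity)] at ih ⊢
    push_cast
    linear_combination (a + 1 / 2 : ℝ) * ih +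
      (a + 1 / 2 : ℝ) * ((b + a).factorial : ℝ) * h2 - 1 / 2 * ((b + a).factorial : ℝ) * h1

/-! ### The kernel as an arcsine mixture, and its action on characters -/

/-- Integration against two independent arcsine distributions. -/
noncomputable def arcsineFunctional₂ : ℝ[X] ⊗[ℝ] ℝ[X] →ₗ[ℝ] ℝ :=
  LinearMap.mul' ℝ ℝ ∘ₗ TensorProduct.map arcsineFunctional arcsineFunctional

theorem arcsineFunctional₂_tmul (P Q : ℝ[X]) :
    arcsineFunctional₂ (P ⊗ₜ Q) = arcsineFunctional P * arcsineFunctional Q := by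
  simp [arcsineFunctional₂]

/-- The bias of the coordinates of a given color, as one of two independent variables. -/
noncomputable def slot (g : ZMod 2) : ℝ[X] →ₐ[ℝ] ℝ[X] ⊗[ℝ] ℝ[X] :=
  if g = 0 then Algebra.TensorProduct.includeLeft else Algebra.TensorProduct.includeRight

theorem slot_mul_slot (P Q : ℝ[X]) : slot 0 P * slot 1 Q = P ⊗ₜ[ℝ] Q := by
  simp [slot]

theorem prod_bits_univ {M : Type*} [CommMonoid M] (f : ZMod 2 → M) : ∏ g, f g = f 0 * f 1 :=
  Fin.prod_univ_two f

theorem sum_bits_univ {M : Type*} [AddCommMonoid M] (f : ZMod 2 → M) : ∑ g, f g = f 0 + f 1 :=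
  Fin.sum_univ_two f

theorem colorCount_eq_add {n : ℕ} (x y : Fin n → ZMod 2) (g : ZMod 2) :
    colorCount x g = colorCount (fun i => (x i, y i)) (g, 0) +
      colorCount (fun i => (x i, y i)) (g, 1) := by
  simp only [colorCount]
  rw [← card_filter_add_card_filter_not (fun i => y i = 0), filter_filter, filter_filter]
  have h01 : ∀ b : ZMod 2, b ≠ 0 ↔ b = 1 := by decide
  simp only [Prod.mk.injEq, ← h01, ne_eq]

theorem binaryBurnside_eq_arcsineFunctional₂ {n : ℕ} (x y : Fin n → ZMod 2) :
    binaryBurnside n x y = arcsineFunctional₂ (∏ i, slot (x i) (bitPoly (y i))) := by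
  have h : ∏ i, slot (x i) (bitPoly (y i)) =
      ∏ g : ZMod 2 × ZMod 2, slot g.1 (bitPoly g.2) ^ colorCount (fun i => (x i, y i)) g := by
    rw [← prod_fiberwise univ (fun i => (x i, y i))]
    refine prod_congr rfl fun g _ => ?_
    rw [colorCount, ← prod_const]
    refine prod_congr rfl fun i hi => ?_
    rw [← (mem_filter.1 hi).2]
  rw [h, Fintype.prod_prod_type, prod_bits_univ, prod_bits_univ, prod_bits_univ]
  simp only [← map_pow, ← map_mul]
  rw [slot_mul_slot, arcsineFunctional₂_tmul, arcsineFunctional_bitPoly,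
    arcsineFunctional_bitPoly, binaryBurnside_apply, Fintype.prod_prod_type, prod_bits_univ,
    prod_bits_univ, prod_bits_univ, prod_bits_univ, ← colorCount_eq_add, ← colorCount_eq_add]
  field_simp

/-- The sign `(-1) ^ b` of a bit. -/
noncomputable def bitSign (b : ZMod 2) : ℝ := if b = 0 then 1 else -1

theorem bitSign_zero : bitSign 0 = 1 := by simp [bitSign]

theorem bitSign_one : bitSign 1 = -1 := by simp [bitSign]

/-- The character of `C_2^n` attached to a set of coordinates. -/
noncomputable def walsh {n : ℕ} (S : Finset (Fin n)) (y : Fin n → ZMod 2) : ℝ :=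
  ∏ i ∈ S, bitSign (y i)

/-- Sums of products of functions of single coordinates factor. -/
theorem sum_prod_bits {n : ℕ} {A : Type*} [CommSemiring A] (f : Fin n → ZMod 2 → A) :
    ∑ y : Fin n → ZMod 2, ∏ i, f i (y i) = ∏ i, (f i 0 + f i 1) := by
  simp_rw [← sum_bits_univ, prod_univ_sum, Fintype.piFinset_univ]

theorem walsh_eq_prod_univ {n : ℕ} (S : Finset (Fin n)) (y : Fin n → ZMod 2) :
    walsh S y = ∏ i, if i ∈ S then bitSign (y i) else 1 := by
  rw [walsh, Fintype.prod_ite_mem]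

/-- Given the biases the new bits are independent, so the sum over y factors: a coordinate in S
contributes its mean sign, which is the bias, and any other contributes 1. -/
theorem binaryBurnside_sum_walsh {n : ℕ} (x : Fin n → ZMod 2) (S : Finset (Fin n)) :
    ∑ y, binaryBurnside n x y * walsh S y = arcsineFunctional₂ (∏ i ∈ S, slot (x i) X) := by
  have h : ∀ y, binaryBurnside n x y * walsh S y = arcsineFunctional₂
      (∏ i, (if i ∈ S then bitSign (y i) else 1) • slot (x i) (bitPoly (y i))) := by
    intro y
    rw [prod_smul, map_smul, smul_eq_mul, ← walsh_eq_prod_univ,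
      binaryBurnside_eq_arcsineFunctional₂, mul_comm]
  rw [sum_congr rfl fun y _ => h y, ← map_sum,
    sum_prod_bits fun i b => (if i ∈ S then bitSign b else 1) • slot (x i) (bitPoly b)]
  congr 1
  rw [← Fintype.prod_ite_mem S]
  refine prod_congr rfl fun i _ => ?_
  split_ifs
  · rw [bitSign_zero, bitSign_one, ← bitPoly_sub, map_sub]
    module
  · rw [one_smul, one_smul, ← map_add, bitPoly_sum, map_one]

/-- Half the sum and half the difference of the two bias variables. -/
noncomputable def halfSum : ℝ[X] ⊗[ℝ] ℝ[X] := (1 / 2 : ℝ) • (slot 0 X + slot 1 X)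

noncomputable def halfDiff : ℝ[X] ⊗[ℝ] ℝ[X] := (1 / 2 : ℝ) • (slot 0 X - slot 1 X)

theorem slot_X_eq (g : ZMod 2) : slot g X = bitSign g • halfDiff + halfSum := by
  have h01 : g = 0 ∨ g = 1 := by revert g; decide
  unfold halfSum halfDiff
  rcases h01 with rfl | rfl
  · rw [bitSign_zero]; module
  · rw [bitSign_one]; module

/-- The coefficients of the binary Burnside kernel in the basis of characters. -/
noncomputable def walshCoeff (m t : ℕ) : ℝ := arcsineFunctional₂ (halfDiff ^ t * halfSum ^ (m - t))

/-- Each bias is the half sum plus or minus the half difference, with sign that of the bit of x.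
Expanding the product over S gives the triangular form. -/
theorem binaryBurnside_sum_walsh_eq_sum {n : ℕ} (x : Fin n → ZMod 2) (S : Finset (Fin n)) :
    ∑ y, binaryBurnside n x y * walsh S y =
      ∑ T ∈ S.powerset, walshCoeff #S #T * walsh T x := by
  rw [binaryBurnside_sum_walsh]
  simp_rw [slot_X_eq]
  rw [prod_add, map_sum]
  refine sum_congr rfl fun T hT => ?_
  rw [prod_smul, prod_const, prod_const, smul_mul_assoc, map_smul,
    card_sdiff_of_subset (mem_powerset.1 hT), smul_eq_mul, mul_comm]
  rfl

/-! ### Eigenvalues -/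

/-- The eigenvalues of the binary Burnside process. -/
noncomputable def burnsideEigenvalue (m : ℕ) : ℝ := walshCoeff m m

theorem burnsideEigenvalue_eq_sum (m : ℕ) : burnsideEigenvalue m =
    (1 / 2) ^ m * ∑ j ∈ range (m + 1),
      (-1) ^ (m - j) * m.choose j * (arcsineMoment j * arcsineMoment (m - j)) := by
  rw [burnsideEigenvalue, walshCoeff, Nat.sub_self, pow_zero, mul_one, halfDiff, _root_.smul_pow,
    map_smul, smul_eq_mul, sub_eq_add_neg, add_pow, map_sum]
  congr 1
  refine sum_congr rfl fun j _ => ?_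
  rw [neg_pow (slot 1 X), show slot 0 X ^ j * ((-1) ^ (m - j) * slot 1 X ^ (m - j)) *
      (m.choose j : ℝ[X] ⊗[ℝ] ℝ[X]) =
      slot 0 (C ((-1 : ℝ) ^ (m - j) * m.choose j) * X ^ j) * slot 1 (X ^ (m - j)) by
    simp only [map_pow, map_mul, map_neg, map_one, map_natCast]
    ring,
    slot_mul_slot, arcsineFunctional₂_tmul, ← smul_eq_C_mul, map_smul, arcsineFunctional_X_pow,
    arcsineFunctional_X_pow, smul_eq_mul, mul_assoc]

theorem burnsideEigenvalue_odd {m : ℕ} (hm : Odd m) : burnsideEigenvalue m = 0 := by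
  rw [burnsideEigenvalue_eq_sum, sum_eq_zero, mul_zero]
  intro j hj
  rcases Nat.even_or_odd j with h | h
  · rw [arcsineMoment_odd (m := m - j)]
    · simp
    · exact Nat.Odd.sub_even (by simpa [Nat.lt_succ_iff] using hj) hm h
  · rw [arcsineMoment_odd h]
    simp

theorem burnsideEigenvalue_two_mul (k : ℕ) :
    burnsideEigenvalue (2 * k) = ((k.centralBinom : ℝ) / 4 ^ k) ^ 2 := by
  rw [burnsideEigenvalue_eq_sum]
  have hsum : ∀ F : ℕ → ℝ, (∀ j, Odd j → F j = 0) →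
      ∑ j ∈ range (2 * k + 1), F j = ∑ j ∈ range (k + 1), F (2 * j) := by
    intro F hF
    induction k with
    | zero => simp
    | succ k ih =>
      rw [show 2 * (k + 1) + 1 = 2 * k + 1 + 1 + 1 by ring, sum_range_succ, sum_range_succ, ih,
        hF _ ⟨k, rfl⟩, add_zero, sum_range_succ _ (k + 1)]
      rfl
  rw [hsum _ fun j hj => by rw [arcsineMoment_odd hj]; simp]
  -- The product of two even arcsine moments with C(2k, 2j) collapses to squares of C(k, j) up to a
  -- common factor, ready for Vandermonde's identity.
  have hterm : ∀ j ∈ range (k + 1), (-1) ^ (2 * k - 2 * j) * ((2 * k).choose (2 * j) : ℝ) *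
      (arcsineMoment (2 * j) * arcsineMoment (2 * k - 2 * j)) =
      k.centralBinom / 4 ^ k * (k.choose j * k.choose (k - j)) := by
    intro j hj
    obtain ⟨l, rfl⟩ := Nat.exists_eq_add_of_le (Nat.lt_succ_iff.1 (mem_range.1 hj))
    rw [show 2 * (j + l) - 2 * j = 2 * l by omega, Nat.add_sub_cancel_left,
      arcsineMoment_two_mul, arcsineMoment_two_mul, Even.neg_one_pow (even_two_mul l), one_mul,
      Nat.centralBinom, Nat.centralBinom, Nat.centralBinom, Nat.choose_symm_add,
      Nat.cast_choose ℝ (show 2 * j ≤ 2 * (j + l) by omega),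
      Nat.cast_choose ℝ (show j ≤ 2 * j by omega), Nat.cast_choose ℝ (show l ≤ 2 * l by omega),
      Nat.cast_choose ℝ (show j + l ≤ 2 * (j + l) by omega),
      Nat.cast_choose ℝ (show l ≤ j + l by omega),
      show 2 * (j + l) - 2 * j = 2 * l by omega, show 2 * j - j = j by omega,
      show 2 * l - l = l by omega, show 2 * (j + l) - (j + l) = j + l by omega,
      show j + l - l = j by omega, pow_add]
    field_simp
  rw [sum_congr rfl hterm, ← mul_sum]
  have hv : ∑ j ∈ range (k + 1), ((k.choose j : ℝ) * k.choose (k - j)) = k.centralBinom := by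
    rw [Nat.centralBinom, two_mul, Nat.add_choose_eq,
      Nat.sum_antidiagonal_eq_sum_range_succ fun a b => k.choose a * k.choose b]
    push_cast
    rfl
  rw [hv, pow_mul, show ((1 : ℝ) / 2) ^ 2 = 1 / 4 by norm_num, one_div_pow]
  ring

/-! ### Spectral bound along a filtration -/

/-- A symmetric operator that acts triangularly along a filtration acts by scalars on the
orthogonal increments of the filtration; this bounds the distance of its powers from the bottom
part in terms of evaluation bounds on the steps of the filtration. -/
theorem norm_sq_pow_sub_le {E : Type*} [NormedAddCommGroup E] [InnerProductSpace ℝ E]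
    [FiniteDimensional ℝ E] {T : E →ₗ[ℝ] E} (hT : T.IsSymmetric) {V : ℕ → Submodule ℝ E}
    (hV : Monotone V) {μ : ℕ → ℝ} (h0 : ∀ f ∈ V 0, T f = μ 0 • f)
    (hμ : ∀ m, ∀ f ∈ V (m + 1), T f - μ (m + 1) • f ∈ V m) {v : E} {Λ : ℕ → ℝ}
    (hΛ0 : ∀ m, 0 ≤ Λ m) (hΛ : ∀ m, ∀ f ∈ V m, inner ℝ f v ^ 2 ≤ Λ m * ‖f‖ ^ 2)
    {n : ℕ} (hv : v ∈ V n) (s : ℕ) :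
    ‖(T ^ s) v - μ 0 ^ s • (V 0).starProjection v‖ ^ 2 ≤
      ∑ m ∈ range n, μ (m + 1) ^ (2 * s) * Λ (m + 1) := by
  have hTV : ∀ m, ∀ f ∈ V m, T f ∈ V m := by
    intro m f hf
    cases m with
    | zero => rw [h0 f hf]; exact (V 0).smul_mem _ hf
    | succ m =>
      have := (V (m + 1)).add_mem (hV (Nat.le_succ m) (hμ m f hf))
        ((V (m + 1)).smul_mem (μ (m + 1)) hf)
      simpa using this
  have hTsV : ∀ s m, ∀ f ∈ V m, (T ^ s) f ∈ V m := by
    intro s m f hf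
    induction s with
    | zero => simpa using hf
    | succ s ih => rw [pow_succ', Module.End.mul_apply]; exact hTV m _ ih
  have hpow : ∀ (s : ℕ) (f : E) (a : ℝ), T f = a • f → (T ^ s) f = a ^ s • f := by
    intro s f a hf
    induction s with
    | zero => simp
    | succ s ih => rw [pow_succ', Module.End.mul_apply, ih, map_smul, hf, smul_smul, pow_succ]
  suffices H : ∀ m, ‖(T ^ s) ((V m).starProjection v) - μ 0 ^ s • (V 0).starProjection v‖ ^ 2 ≤
      ∑ j ∈ range m, μ (j + 1) ^ (2 * s) * Λ (j + 1) by
    have := H n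
    rwa [Submodule.starProjection_eq_self_iff.2 hv] at this
  intro m
  induction m with
  | zero => rw [hpow _ _ _ (h0 _ ((V 0).starProjection_apply_mem v))]; simp
  | succ m ih =>
    set a := (V m).starProjection v with ha
    set b := (V (m + 1)).starProjection v with hb
    have haV : a ∈ V m := (V m).starProjection_apply_mem v
    have hbV : b ∈ V (m + 1) := (V (m + 1)).starProjection_apply_mem v
    have hwV : b - a ∈ V (m + 1) := (V (m + 1)).sub_mem hbV (hV (Nat.le_succ m) haV)
    have hvb : ∀ u ∈ V (m + 1), inner ℝ u (v - b) = 0 := fun u hu =>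
      (V (m + 1)).inner_right_of_mem_orthogonal hu ((V (m + 1)).sub_starProjection_mem_orthogonal v)
    have hva : ∀ u ∈ V m, inner ℝ u (v - a) = 0 := fun u hu =>
      (V m).inner_right_of_mem_orthogonal hu ((V m).sub_starProjection_mem_orthogonal v)
    have hw : ∀ u ∈ V m, inner ℝ u (b - a) = 0 := by
      intro u hu
      have h1 := hva u hu
      have h2 := hvb u (hV (Nat.le_succ m) hu)
      rw [inner_sub_right] at h1 h2 ⊢
      linarith
    -- The defect r lies in `V m`, and so does T r. As b - a is orthogonal to `V m`, symmetry gives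
    -- ⟨r, r⟩ = ⟨T r, b - a⟩ - μ ⟨r, b - a⟩ = 0.
    have hTw : T (b - a) = μ (m + 1) • (b - a) := by
      rw [← sub_eq_zero, ← inner_self_eq_zero (𝕜 := ℝ)]
      have hmem := hμ m _ hwV
      set r := T (b - a) - μ (m + 1) • (b - a) with hr
      nth_rewrite 2 [hr]
      rw [inner_sub_right, inner_smul_right, ← hT r (b - a), hw _ (hTV m r hmem), hw _ hmem]
      simp
    -- Pairing the increment with v gives its squared norm, so the evaluation bound reads ‖b - a‖⁴ ≤
    -- Λ ‖b - a‖².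
    have hnorm : ‖b - a‖ ^ 2 ≤ Λ (m + 1) := by
      have h1 : inner ℝ (b - a) v = ‖b - a‖ ^ 2 := by
        have h2 := hvb _ hwV
        have h3 := hw a haV
        rw [real_inner_comm] at h3
        rw [inner_sub_right] at h2
        rw [← real_inner_self_eq_norm_sq, inner_sub_right (b - a) b a]
        linarith
      have h2 := hΛ (m + 1) _ hwV
      rw [h1] at h2
      rcases (sq_nonneg ‖b - a‖).eq_or_lt with h | h
      · rw [← h]; exact hΛ0 _
      · rw [pow_two (‖b - a‖ ^ 2)] at h2
        exact le_of_mul_le_mul_right h2 h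
    have hsplit : (T ^ s) b - μ 0 ^ s • (V 0).starProjection v =
        ((T ^ s) a - μ 0 ^ s • (V 0).starProjection v) + μ (m + 1) ^ s • (b - a) := by
      rw [← hpow _ _ _ hTw, map_sub]
      abel
    have hmem : (T ^ s) a - μ 0 ^ s • (V 0).starProjection v ∈ V m :=
      (V m).sub_mem (hTsV s m a haV)
        ((V m).smul_mem _ (hV (Nat.zero_le m) ((V 0).starProjection_apply_mem v)))
    -- Pythagoras: the cross term vanishes because the first summand lies in `V m`.
    rw [hsplit, norm_add_sq_real, inner_smul_right, hw _ hmem, sum_range_succ, norm_smul, mul_pow,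
      Real.norm_eq_abs, sq_abs, ← pow_mul, mul_comm s 2]
    have := mul_le_mul_of_nonneg_left hnorm
      ((even_two_mul s).pow_nonneg (μ (m + 1)))
    linarith

/-! ### The Christoffel function at 0 for the weight p on [0, 1] -/

/-- The matrix 1/(j + k + 2) is the Gram matrix of the monomials for the weight p, and c is the
first column of its inverse. The c k are the partial fraction residues of P(z)/∏(z + k + 2), where P
vanishes at 1, …, m and A normalizes the value at 0 to 1. The residue at -2 is the Christoffel
constant. -/
theorem exists_dual_moments (m : ℕ) : ∃ c : ℕ → ℝ,
    (∀ j ≤ m, ∑ k ∈ range (m + 1), c k / (j + k + 2) = if j = 0 then 1 else 0) ∧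
      c 0 = ((m + 1) * (m + 2)) ^ 2 / 2 := by
  set ν : ℕ → ℝ := fun k => -(k + 2)
  set A : ℝ := (-1) ^ m * ((m + 1) * (m + 2))
  set P : ℝ[X] := C A * ∏ j ∈ range m, (X - C (j + 1 : ℝ))
  have hinj : Set.InjOn ν (range (m + 1)) := by
    intro a _ b _ hab
    have : (a : ℝ) = b := by simp only [ν] at hab; linarith
    exact_mod_cast this
  have hdeg : P.degree < #(range (m + 1)) := by
    rw [card_range]
    have hA : A ≠ 0 := mul_ne_zero (by simp) (by positivity)
    rw [degree_C_mul hA, degree_prod]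
    simp only [degree_X_sub_C, sum_const, card_range, nsmul_eq_mul, mul_one]
    exact_mod_cast Nat.lt_succ_self m
  have hinterp := Lagrange.eq_interpolate hinj hdeg
  have hP : ∀ z : ℝ, P.eval z = A * ∏ j ∈ range m, (z - (j + 1)) := by
    intro z
    simp [P, eval_prod]
  have hfact : ∏ k ∈ range (m + 1), ((k : ℝ) + 2) = (m + 2).factorial := by
    have : ((m + 2).factorial : ℝ) = ∏ k ∈ range (m + 2), ((k : ℝ) + 1) := by
      rw [← prod_range_add_one_eq_factorial]; push_cast; rfl
    rw [this, prod_range_succ' _ (m + 1)]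
    simp only [Nat.cast_add, Nat.cast_one, add_assoc, one_add_one_eq_two, Nat.cast_zero, zero_add,
      mul_one]
  have hfact' : ∏ k ∈ range m, ((k : ℝ) + 1) = m.factorial := by
    rw [← prod_range_add_one_eq_factorial]; push_cast; rfl
  refine ⟨fun k => Lagrange.nodalWeight (range (m + 1)) ν k * P.eval (ν k), ?_, ?_⟩
  · intro j hj
    have hne : ∀ i ∈ range (m + 1), (j : ℝ) ≠ ν i := by
      intro i _
      have : ν i < j := by
        simp only [ν]
        linarith [i.cast_nonneg (α := ℝ), j.cast_nonneg (α := ℝ)]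
      exact this.ne'
    have h := Lagrange.eval_interpolate_not_at_node (fun i => P.eval (ν i)) hne
    rw [← hinterp] at h
    have hsum : ∑ k ∈ range (m + 1), Lagrange.nodalWeight (range (m + 1)) ν k * P.eval (ν k) /
        ((j : ℝ) + k + 2) = P.eval (j : ℝ) / eval (j : ℝ) (Lagrange.nodal (range (m + 1)) ν) := by
      rw [h, mul_div_cancel_left₀ _ (Lagrange.eval_nodal_not_at_node hne)]
      refine sum_congr rfl fun k _ => ?_
      simp only [ν]
      rw [show (j : ℝ) - -(k + 2) = j + k + 2 by ring]
      ring
    rw [hsum]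
    split_ifs with hj0
    · subst hj0
      rw [Lagrange.eval_nodal, hP]
      simp only [ν, Nat.cast_zero, zero_sub, neg_neg, hfact]
      rw [prod_neg, card_range, hfact', Nat.factorial_succ, Nat.factorial_succ]
      rw [div_eq_one_iff_eq (by positivity)]
      have : ((-1 : ℝ) ^ m) * (-1) ^ m = 1 := by rw [← mul_pow]; norm_num
      simp only [A]
      push_cast
      linear_combination (((m : ℝ) + 1) * (m + 2) * m.factorial) * this
    · rw [hP, prod_eq_zero (i := j - 1), mul_zero, zero_div]
      · rw [mem_range]; omega
      · rw [Nat.cast_sub (by omega)]; simp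
  · have herase : (range (m + 1)).erase 0 = (range m).image (· + 1) := by
      ext k
      simp only [mem_erase, mem_range, mem_image]
      constructor
      · intro h; exact ⟨k - 1, by omega, by omega⟩
      · rintro ⟨a, h, rfl⟩; omega
    simp only [Lagrange.nodalWeight, hP]
    rw [herase, prod_image (by simp)]
    simp only [ν]
    have e1 : ∏ x ∈ range m, (-(((0 : ℕ) : ℝ) + 2) - -(((x + 1 : ℕ) : ℝ) + 2))⁻¹ =
        (m.factorial : ℝ)⁻¹ := by
      rw [← hfact', ← prod_inv_distrib]
      refine prod_congr rfl fun x _ => ?_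
      push_cast
      ring_nf
    have e2 : 2 * ∏ x ∈ range m, (-(((0 : ℕ) : ℝ) + 2) - ((x : ℝ) + 1)) =
        (-1) ^ m * (m + 2).factorial := by
      have : ∀ x : ℕ, (-(((0 : ℕ) : ℝ) + 2) - ((x : ℝ) + 1)) = -((x : ℝ) + 1 + 2) := by
        intro x; push_cast; ring
      simp only [this]
      rw [prod_neg, card_range, ← hfact, prod_range_succ']
      push_cast
      ring
    rw [e1]
    have h1 : ((-1 : ℝ) ^ m) * (-1) ^ m = 1 := by rw [← mul_pow]; norm_num
    have h2 : ((m + 2).factorial : ℝ) = (m + 2) * ((m + 1) * m.factorial) := by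
      rw [Nat.factorial_succ, Nat.factorial_succ]; push_cast; ring
    rw [h2] at e2
    have h3 : (m.factorial : ℝ) ≠ 0 := by positivity
    simp only [A]
    field_simp
    linear_combination (-1) ^ m * e2 + ((m + 1) * (m + 2) * m.factorial : ℝ) * h1

theorem integral_mul_eval_mul_eval (F H : ℝ[X]) {m : ℕ} (hF : F.natDegree ≤ m)
    (hH : H.natDegree ≤ m) : ∫ p in (0 : ℝ)..1, p * (F.eval p * H.eval p) =
      ∑ j ∈ range (m + 1), F.coeff j * ∑ k ∈ range (m + 1), H.coeff k / (j + k + 2) := by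
  have h : ∀ p : ℝ, p * (F.eval p * H.eval p) = ∑ j ∈ range (m + 1), ∑ k ∈ range (m + 1),
      F.coeff j * H.coeff k * p ^ (j + k + 1) := by
    intro p
    rw [eval_eq_sum_range' (Nat.lt_succ_of_le hF), eval_eq_sum_range' (Nat.lt_succ_of_le hH),
      sum_mul_sum, mul_sum]
    refine sum_congr rfl fun j _ => ?_
    rw [mul_sum]
    refine sum_congr rfl fun k _ => ?_
    ring
  simp only [h]
  rw [intervalIntegral.integral_finsetSum fun j _ =>
    (by fun_prop : Continuous _).intervalIntegrable _ _]
  refine sum_congr rfl fun j _ => ?_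
  rw [intervalIntegral.integral_finsetSum fun j _ =>
    (by fun_prop : Continuous _).intervalIntegrable _ _, mul_sum]
  refine sum_congr rfl fun k _ => ?_
  rw [intervalIntegral.integral_const_mul, integral_pow]
  push_cast
  ring

/-- The Christoffel bound at `0` for the weight `p` on `[0, 1]`. -/
theorem sq_eval_zero_le {F : ℝ[X]} {m : ℕ} (hF : F.natDegree ≤ m) :
    F.eval 0 ^ 2 ≤ ((m + 1) * (m + 2)) ^ 2 / 2 * ∫ p in (0 : ℝ)..1, p * F.eval p ^ 2 := by
  obtain ⟨c, hc, hc0⟩ := exists_dual_moments m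
  set B : ℝ := ((m + 1) * (m + 2)) ^ 2 / 2
  have hB : 0 < B := by positivity
  set H : ℝ[X] := ∑ k ∈ range (m + 1), C (c k) * X ^ k
  have hcoeff : ∀ k ∈ range (m + 1), H.coeff k = c k := by
    intro k hk
    rw [mem_range] at hk
    simp only [H, finsetSum_coeff, coeff_C_mul, coeff_X_pow, mul_ite, mul_one, mul_zero,
      sum_ite_eq, mem_range, hk, if_true]
  have hH : H.natDegree ≤ m := natDegree_sum_le_of_forall_le _ _ fun k hk =>
    (natDegree_C_mul_X_pow_le _ _).trans (Nat.lt_succ_iff.1 (mem_range.1 hk))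
  -- H is the reproducing kernel at 0, so its squared norm is H(0) = c 0 = B.
  have hdual : ∀ Q : ℝ[X], Q.natDegree ≤ m →
      ∫ p in (0 : ℝ)..1, p * (Q.eval p * H.eval p) = Q.coeff 0 := by
    intro Q hQ
    rw [integral_mul_eval_mul_eval Q H hQ hH]
    have : ∀ j ∈ range (m + 1), Q.coeff j * ∑ k ∈ range (m + 1), H.coeff k / ((j : ℝ) + k + 2) =
        if j = 0 then Q.coeff 0 else 0 := by
      intro j hj
      rw [sum_congr rfl fun k hk => by rw [hcoeff k hk], hc j (Nat.lt_succ_iff.1 (mem_range.1 hj))]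
      split_ifs with h <;> simp [h]
    rw [sum_congr rfl this]
    simp
  have hFH := hdual F hF
  have hHH := hdual H hH
  rw [hcoeff 0 (by simp), hc0] at hHH
  rw [coeff_zero_eq_eval_zero] at hFH
  -- The minimizer of the quadratic ∫ p (F - tH)², whose nonnegativity is the Cauchy–Schwarz
  -- inequality.
  set t : ℝ := F.eval 0 / B
  have hint : ∀ Q R : ℝ[X], IntervalIntegrable (fun p : ℝ => p * (Q.eval p * R.eval p))
      MeasureTheory.volume 0 1 := fun Q R =>
    (by fun_prop : Continuous fun p : ℝ => p * (Q.eval p * R.eval p)).intervalIntegrable _ _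
  have hpos : 0 ≤ ∫ p in (0 : ℝ)..1, p * (F.eval p - t * H.eval p) ^ 2 :=
    intervalIntegral.integral_nonneg zero_le_one fun p hp => mul_nonneg hp.1 (sq_nonneg _)
  have hexp : ∀ p : ℝ, p * (F.eval p - t * H.eval p) ^ 2 =
      p * (F.eval p * F.eval p) - 2 * t * (p * (F.eval p * H.eval p)) +
        t ^ 2 * (p * (H.eval p * H.eval p)) := fun p => by ring
  simp only [hexp] at hpos
  rw [intervalIntegral.integral_add (((hint F F).sub ((hint F H).const_mul _)))
      ((hint H H).const_mul _), intervalIntegral.integral_sub (hint F F)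
      ((hint F H).const_mul _), intervalIntegral.integral_const_mul,
    intervalIntegral.integral_const_mul, hFH, hHH] at hpos
  simp only [pow_two (F.eval _)]
  have ht : t * B = F.eval 0 := div_mul_cancel₀ _ hB.ne'
  have : B * (2 * t * F.eval 0 - t ^ 2 * B) = F.eval 0 * F.eval 0 := by
    rw [← ht]; ring
  rw [← this]
  exact mul_le_mul_of_nonneg_left (by linarith) hB.le

/-! ### Pair correlations, and the stationary law as a mixture of Bernoulli laws -/

theorem integral_pow_mul_one_sub_pow (a b : ℕ) :
    ∫ p in (0 : ℝ)..1, p ^ a * (1 - p) ^ b = a.factorial * b.factorial / (a + b + 1).factorial := by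
  induction b generalizing a with
  | zero =>
    simp only [pow_zero, mul_one, integral_pow, Nat.factorial_succ]
    push_cast
    field_simp
    simp
  | succ b ih =>
    have hder : ∀ p : ℝ, HasDerivAt (fun p : ℝ => p ^ (a + 1) * (1 - p) ^ (b + 1))
        ((a + 1) * (p ^ a * (1 - p) ^ (b + 1)) - (b + 1) * (p ^ (a + 1) * (1 - p) ^ b)) p := by
      intro p
      have h1 := hasDerivAt_pow (a + 1) p
      have h2 := ((hasDerivAt_id p).const_sub 1).pow (b + 1)
      refine (h1.mul h2).congr_deriv ?_
      simp only [Pi.pow_apply, id, Nat.add_sub_cancel]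
      push_cast
      ring
    have h := intervalIntegral.integral_eq_sub_of_hasDerivAt (fun p _ => hder p)
      ((by fun_prop : Continuous _).intervalIntegrable 0 1)
    rw [intervalIntegral.integral_sub
      ((by fun_prop : Continuous _).intervalIntegrable _ _)
      ((by fun_prop : Continuous _).intervalIntegrable _ _), intervalIntegral.integral_const_mul,
      intervalIntegral.integral_const_mul, ih] at h
    have h' : ((a : ℝ) + 1) * ∫ p in (0 : ℝ)..1, p ^ a * (1 - p) ^ (b + 1) =
        (b + 1) * ((a + 1).factorial * b.factorial / (a + 1 + b + 1).factorial) := by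
      rw [sub_self, zero_pow (Nat.succ_ne_zero a), zero_pow (Nat.succ_ne_zero b)] at h
      linarith
    rw [show a + 1 + b + 1 = a + (b + 1) + 1 by ring, Nat.factorial_succ a] at h'
    rw [Nat.factorial_succ b]
    have ha : (a : ℝ) + 1 ≠ 0 := by positivity
    refine mul_left_cancel₀ ha (h'.trans ?_)
    push_cast
    ring

theorem walsh_empty {n : ℕ} (y : Fin n → ZMod 2) : walsh ∅ y = 1 := by simp [walsh]

theorem walsh_pair {n : ℕ} {i j : Fin n} (hij : i ≠ j) (y : Fin n → ZMod 2) :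
    walsh {i, j} y = bitSign (y i) * bitSign (y j) := prod_pair hij

theorem binaryBurnside_sum_walsh_pair {n : ℕ} {i j : Fin n} (hij : i ≠ j) (x : Fin n → ZMod 2) :
    ∑ y, binaryBurnside n x y * (bitSign (y i) * bitSign (y j)) =
      1 / 4 + 1 / 4 * (bitSign (x i) * bitSign (x j)) := by
  have h := binaryBurnside_sum_walsh x {i, j}
  simp only [walsh_pair hij] at h
  rw [h, prod_pair hij]
  have h1 : arcsineFunctional 1 = 1 := by
    have := arcsineFunctional_X_pow 0
    simpa [arcsineMoment] using this
  have h2 : arcsineFunctional (X * X) = 1 / 2 := by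
    rw [← pow_two, arcsineFunctional_X_pow, show 2 = 2 * 1 by rfl, arcsineMoment_two_mul]
    norm_num [Nat.centralBinom]
  have h3 : arcsineFunctional X = 0 := by
    have := arcsineFunctional_X_pow 1
    rwa [pow_one, arcsineMoment_odd odd_one] at this
  have h01 : ∀ g : ZMod 2, g = 0 ∨ g = 1 := by decide
  have e0 : arcsineFunctional₂ (slot 0 X * slot 0 X) = 1 / 2 := by
    rw [← map_mul, ← mul_one (slot 0 (X * X)), ← map_one (slot 1), slot_mul_slot,
      arcsineFunctional₂_tmul, h1, h2, mul_one]
  have e1 : arcsineFunctional₂ (slot 1 X * slot 1 X) = 1 / 2 := by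
    rw [← map_mul, ← one_mul (slot 1 (X * X)), ← map_one (slot 0), slot_mul_slot,
      arcsineFunctional₂_tmul, h1, h2, one_mul]
  have e2 : arcsineFunctional₂ (slot 0 X * slot 1 X) = 0 := by
    rw [slot_mul_slot, arcsineFunctional₂_tmul, h3, mul_zero]
  rcases h01 (x i) with hi | hi <;> rcases h01 (x j) with hj | hj <;> rw [hi, hj]
  · rw [e0, bitSign_zero]; norm_num
  · rw [e2, bitSign_zero, bitSign_one]; norm_num
  · rw [mul_comm, e2, bitSign_zero, bitSign_one]; norm_num
  · rw [e1, bitSign_one]; norm_num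

theorem binaryBurnside_row_sum {n : ℕ} (x : Fin n → ZMod 2) : ∑ y, binaryBurnside n x y = 1 := by
  have h := binaryBurnside_sum_walsh x ∅
  have h1 : arcsineFunctional 1 = 1 := by
    have := arcsineFunctional_X_pow 0
    simpa [arcsineMoment] using this
  simp only [walsh_empty, mul_one, prod_empty] at h
  rw [h, Algebra.TensorProduct.one_def, arcsineFunctional₂_tmul, h1, mul_one]

theorem binaryStationary_eq_integral {n : ℕ} (y : Fin n → ZMod 2) :
    binaryStationary n y = ∫ p in (0 : ℝ)..1, ∏ j, if y j = 0 then 1 - p else p := by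
  have h : ∀ p : ℝ, (∏ j, if y j = 0 then 1 - p else p) =
      p ^ colorCount y 1 * (1 - p) ^ colorCount y 0 := by
    intro p
    rw [prod_ite, prod_const, prod_const, mul_comm]
    have h01 : ∀ b : ZMod 2, ¬b = 0 ↔ b = 1 := by decide
    simp only [h01]
    rfl
  have hn : colorCount y 1 + colorCount y 0 = n := by
    have := card_filter_add_card_filter_not (s := univ) (fun i => y i = 1)
    have h01 : ∀ b : ZMod 2, ¬b = 1 ↔ b = 0 := by decide
    simp only [h01, card_univ, Fintype.card_fin] at this
    rw [colorCount, colorCount]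
    convert this
  simp only [h]
  rw [integral_pow_mul_one_sub_pow, hn, binaryStationary_apply, prod_bits_univ, mul_comm]

theorem sum_binaryStationary_mul {n : ℕ} (f : (Fin n → ZMod 2) → ℝ) :
    ∑ y, binaryStationary n y * f y =
      ∫ p in (0 : ℝ)..1, ∑ y, (∏ j, if y j = 0 then 1 - p else p) * f y := by
  have hc : ∀ y : Fin n → ZMod 2, Continuous fun p : ℝ => ∏ j, if y j = 0 then 1 - p else p :=
    fun y => continuous_finsetProd _ fun j _ => by split_ifs <;> fun_prop
  have hi : ∀ y ∈ univ, IntervalIntegrable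
      (fun p : ℝ => (∏ j, if y j = 0 then 1 - p else p) * f y) MeasureTheory.volume 0 1 :=
    fun y _ => ((hc y).mul continuous_const).intervalIntegrable _ _
  rw [intervalIntegral.integral_finsetSum hi]
  refine sum_congr rfl fun y _ => ?_
  rw [intervalIntegral.integral_mul_const, binaryStationary_eq_integral]

theorem sum_binaryStationary (n : ℕ) : ∑ y, binaryStationary n y = 1 := by
  have h := sum_binaryStationary_mul (n := n) fun _ => 1
  simp only [mul_one] at h
  rw [h]
  have : ∀ p : ℝ, ∑ y : Fin n → ZMod 2, (∏ j, if y j = 0 then 1 - p else p) = 1 := by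
    intro p
    rw [sum_prod_bits fun _ b => if b = 0 then 1 - p else p]
    simp
  simp [this]

/-! ### The degree filtration -/

/-- The functions on `C_2^n` of degree at most `m`. -/
noncomputable def walshSpan (n m : ℕ) : Submodule ℝ ((Fin n → ZMod 2) → ℝ) :=
  Submodule.span ℝ {f | ∃ S : Finset (Fin n), #S ≤ m ∧ f = walsh S}

theorem walsh_mem_walshSpan {n m : ℕ} {S : Finset (Fin n)} (hS : #S ≤ m) :
    walsh S ∈ walshSpan n m :=
  Submodule.subset_span ⟨S, hS, rfl⟩

theorem walshSpan_mono (n : ℕ) : Monotone (walshSpan n) := fun _ _ h =>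
  Submodule.span_mono fun _ ⟨S, hS, hf⟩ => ⟨S, hS.trans h, hf⟩

theorem single_mem_walshSpan {n : ℕ} (x : Fin n → ZMod 2) (a : ℝ) :
    Pi.single x a ∈ walshSpan n n := by
  have h : (Pi.single x a : (Fin n → ZMod 2) → ℝ) =
      ∑ T ∈ (univ : Finset (Fin n)).powerset,
        (a * ((∏ i ∈ T, 1 / 2 * bitSign (x i)) * ∏ i ∈ univ \ T, (1 / 2 : ℝ))) • walsh T := by
    ext y
    -- The indicator of a point is a product of one-coordinate indicators, each affine in the sign;
    -- expanding it yields characters.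
    have h1 : ∀ i, (1 / 2 * bitSign (x i) * bitSign (y i) + 1 / 2 : ℝ) =
        if y i = x i then 1 else 0 := by
      intro i
      have h01 : ∀ g : ZMod 2, g = 0 ∨ g = 1 := by decide
      rcases h01 (x i) with hi | hi <;> rcases h01 (y i) with hj | hj <;> rw [hi, hj] <;>
        norm_num [bitSign]
    have h2 : ∏ i, (1 / 2 * bitSign (x i) * bitSign (y i) + 1 / 2 : ℝ) =
        if y = x then 1 else 0 := by
      simp only [h1, funext_iff, prod_boole, mem_univ, forall_const]
    rw [prod_add] at h2
    simp only [Finset.sum_apply, Pi.smul_apply, smul_eq_mul, walsh]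
    rw [Pi.single_apply, ← mul_boole, ← h2, mul_sum]
    refine sum_congr rfl fun T _ => ?_
    rw [prod_mul_distrib (g := fun i => bitSign (y i))]
    ring
  rw [h]
  exact Submodule.sum_mem _ fun T _ => Submodule.smul_mem _ _
    (walsh_mem_walshSpan ((card_le_univ T).trans_eq (Fintype.card_fin n)))

theorem binaryBurnside_sub_mem_walshSpan {n m : ℕ} {f : (Fin n → ZMod 2) → ℝ}
    (hf : f ∈ walshSpan n (m + 1)) :
    (binaryBurnside n).mulVec f - burnsideEigenvalue (m + 1) • f ∈ walshSpan n m := by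
  induction hf using Submodule.span_induction with
  | zero => simp
  | add f g _ _ hf hg =>
    rw [Matrix.mulVec_add, smul_add, add_sub_add_comm]
    exact Submodule.add_mem _ hf hg
  | smul a f _ hf =>
    rw [Matrix.mulVec_smul, smul_comm, ← smul_sub]
    exact Submodule.smul_mem _ _ hf
  | mem f hf =>
    obtain ⟨S, hS, rfl⟩ := hf
    have h : (binaryBurnside n).mulVec (walsh S) =
        walshCoeff #S #S • walsh S + ∑ T ∈ S.powerset.erase S, walshCoeff #S #T • walsh T := by
      ext x
      rw [add_sum_erase _ (fun T => walshCoeff #S #T • walsh T) (mem_powerset_self S)]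
      simp only [Finset.sum_apply, Pi.smul_apply, smul_eq_mul]
      exact binaryBurnside_sum_walsh_eq_sum x S
    have hlt : ∀ T ∈ S.powerset.erase S, #T < #S := fun T hT =>
      card_lt_card ((mem_powerset.1 (mem_of_mem_erase hT)).ssubset_of_ne (ne_of_mem_erase hT))
    have hsum : ∑ T ∈ S.powerset.erase S, walshCoeff #S #T • walsh T ∈ walshSpan n m :=
      Submodule.sum_mem _ fun T hT => Submodule.smul_mem _ _
        (walsh_mem_walshSpan (Nat.lt_succ_iff.1 ((hlt T hT).trans_le hS)))
    rw [h]
    rcases hS.eq_or_lt with hS' | hS'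
    · rw [hS', burnsideEigenvalue, add_sub_cancel_left, ← hS']
      exact hsum
    · have hSm := walsh_mem_walshSpan (Nat.lt_succ_iff.1 hS')
      exact Submodule.sub_mem _ (Submodule.add_mem _ (Submodule.smul_mem _ _ hSm) hsum)
        (Submodule.smul_mem _ _ hSm)

theorem eq_const_of_mem_walshSpan_zero {n : ℕ} {f : (Fin n → ZMod 2) → ℝ}
    (hf : f ∈ walshSpan n 0) : ∃ a : ℝ, f = fun _ => a := by
  induction hf using Submodule.span_induction with
  | zero => exact ⟨0, rfl⟩
  | add f g _ _ hf hg =>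
    obtain ⟨a, rfl⟩ := hf
    obtain ⟨b, rfl⟩ := hg
    exact ⟨a + b, rfl⟩
  | smul c f _ hf =>
    obtain ⟨a, rfl⟩ := hf
    exact ⟨c * a, rfl⟩
  | mem f hf =>
    obtain ⟨S, hS, rfl⟩ := hf
    rw [Nat.le_zero, card_eq_zero] at hS
    subst hS
    exact ⟨1, funext walsh_empty⟩

/-! ### Point evaluation at a state with one 1 -/

/-- The law of each coordinate of a tuple of independent bits of bias `X`, conditioned on a `1` at
coordinate `i`. -/
noncomputable def condBitPoly {n : ℕ} (i j : Fin n) (b : ZMod 2) : ℝ[X] :=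
  if j = i then (if b = 0 then 0 else 1) else if b = 0 then 1 - X else X

/-- The expectation of a function of independent bits of bias `X`, conditioned on a `1` at
coordinate `i`. -/
noncomputable def condMean {n : ℕ} (i : Fin n) (f : (Fin n → ZMod 2) → ℝ) : ℝ[X] :=
  ∑ y, f y • ∏ j, condBitPoly i j (y j)

/-- By independence a character becomes a product over its coordinates of the mean signs: 1 - 2X
away from i and the constant -1 at i. -/
theorem natDegree_condMean_le {n m : ℕ} (i : Fin n) {f : (Fin n → ZMod 2) → ℝ}
    (hf : f ∈ walshSpan n m) : (condMean i f).natDegree ≤ m := by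
  induction hf using Submodule.span_induction with
  | zero => simp [condMean]
  | add f g _ _ hf hg =>
    have : condMean i (f + g) = condMean i f + condMean i g := by
      simp only [condMean, Pi.add_apply, add_smul, sum_add_distrib]
    rw [this]
    exact natDegree_add_le_of_degree_le hf hg
  | smul a f _ hf =>
    have : condMean i (a • f) = a • condMean i f := by
      simp only [condMean, Pi.smul_apply, smul_eq_mul, mul_smul, smul_sum]
    rw [this]
    exact (natDegree_smul_le _ _).trans hf
  | mem f hf =>
    obtain ⟨S, hS, rfl⟩ := hf
    have h : condMean i (walsh S) =
        ∏ j ∈ S, (bitSign 0 • condBitPoly i j 0 + bitSign 1 • condBitPoly i j 1) := by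
      have h1 : ∀ y : Fin n → ZMod 2, walsh S y • ∏ j, condBitPoly i j (y j) =
          ∏ j, (if j ∈ S then bitSign (y j) else 1) • condBitPoly i j (y j) := by
        intro y
        rw [prod_smul, ← walsh_eq_prod_univ]
      rw [condMean, sum_congr rfl fun y _ => h1 y,
        sum_prod_bits fun j b => (if j ∈ S then bitSign b else 1) • condBitPoly i j b,
        ← Fintype.prod_ite_mem S]
      refine prod_congr rfl fun j _ => ?_
      split_ifs
      · rfl
      · simp only [condBitPoly]; split_ifs <;> simp_all
    rw [h]
    refine (natDegree_prod_le _ _).trans ((sum_le_card_nsmul _ _ 1 fun j _ => ?_).trans ?_)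
    · rw [bitSign_zero, bitSign_one]
      simp only [condBitPoly, if_true, one_ne_zero, if_false]
      split_ifs
      · simp
      · rw [show (1 : ℝ) • (1 - X) + (-1 : ℝ) • X = (C (-2) * X + C 1 : ℝ[X]) by
          rw [one_smul, neg_smul, one_smul, C_neg, C_ofNat, C_1]; ring]
        exact natDegree_linear_le
    · simpa using hS

theorem eval_condMean {n : ℕ} (i : Fin n) (f : (Fin n → ZMod 2) → ℝ) (p : ℝ) :
    (condMean i f).eval p = ∑ y, f y * ∏ j, (condBitPoly i j (y j)).eval p := by
  simp [condMean, eval_finsetSum, eval_prod]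

theorem eval_zero_condMean {n : ℕ} (i : Fin n) (f : (Fin n → ZMod 2) → ℝ) :
    (condMean i f).eval 0 = f (singleOne i) := by
  rw [eval_condMean]
  have h : ∀ y : Fin n → ZMod 2, ∏ j, (condBitPoly i j (y j)).eval 0 =
      if y = singleOne i then 1 else 0 := by
    intro y
    have h1 : ∀ j, (condBitPoly i j (y j)).eval 0 = if y j = singleOne i j then (1 : ℝ) else 0 := by
      intro j
      have h01 : ∀ g : ZMod 2, g = 0 ∨ g = 1 := by decide
      simp only [condBitPoly, singleOne, Pi.single_apply]
      rcases h01 (y j) with hj | hj <;> rw [hj] <;> clear h01 <;> split_ifs <;> simp_all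
    simp only [h1, funext_iff, prod_boole, mem_univ, forall_const]
  simp [h]

/-- Functions of low degree are controlled at a state with exactly one `1` by their norm in
`L²(π)`, uniformly in the dimension. -/
theorem sq_apply_singleOne_le {n m : ℕ} (i : Fin n) {f : (Fin n → ZMod 2) → ℝ}
    (hf : f ∈ walshSpan n m) :
    f (singleOne i) ^ 2 ≤
      ((m + 1) * (m + 2)) ^ 2 / 2 * ∑ y, binaryStationary n y * f y ^ 2 := by
  have h := sq_eval_zero_le (natDegree_condMean_le i hf)
  rw [eval_zero_condMean] at h
  refine h.trans (mul_le_mul_of_nonneg_left ?_ (by positivity))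
  rw [sum_binaryStationary_mul]
  have hc : ∀ y : Fin n → ZMod 2, Continuous fun p : ℝ => ∏ j, if y j = 0 then 1 - p else p :=
    fun y => continuous_finsetProd _ fun j _ => by split_ifs <;> fun_prop
  refine intervalIntegral.integral_mono_on zero_le_one
    ((by fun_prop : Continuous _).intervalIntegrable _ _)
    ((continuous_finsetSum _ fun y _ => (hc y).mul continuous_const).intervalIntegrable _ _)
    fun p hp => ?_
  have hp1 : 0 ≤ 1 - p := sub_nonneg.2 hp.2
  set w : (Fin n → ZMod 2) → ℝ := fun y => ∏ j, (condBitPoly i j (y j)).eval p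
  have hfac : ∀ j b, 0 ≤ (condBitPoly i j b).eval p := by
    intro j b
    unfold condBitPoly
    split_ifs <;> simp [hp.1, hp.2]
  have hw : ∀ y, 0 ≤ w y := fun y => prod_nonneg fun j _ => hfac j (y j)
  have hw1 : ∑ y, w y = 1 := by
    rw [sum_prod_bits fun j b => (condBitPoly i j b).eval p]
    refine prod_eq_one fun j _ => ?_
    simp only [condBitPoly]
    split_ifs <;> simp_all
  -- Jensen's inequality for the conditional law w.
  have hcs : (condMean i f).eval p ^ 2 ≤ ∑ y, w y * f y ^ 2 := by
    rw [eval_condMean]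
    refine (sum_sq_le_sum_mul_sum_of_sq_le_mul univ (f := fun y => w y * f y ^ 2) (g := w)
      (fun y _ => mul_nonneg (hw y) (sq_nonneg _)) (fun y _ => hw y) fun y _ => ?_).trans_eq ?_
    · change (f y * w y) ^ 2 ≤ _
      exact le_of_eq (by ring)
    · rw [hw1, mul_one]
  refine (mul_le_mul_of_nonneg_left hcs hp.1).trans ?_
  rw [mul_sum]
  refine sum_le_sum fun y _ => ?_
  rw [← mul_assoc]
  refine mul_le_mul_of_nonneg_right ?_ (sq_nonneg _)
  -- It remains to see that p times the conditional law is at most the Bernoulli law. They agree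
  -- away from i, and at i the factor p survives only when the bit is 1. This p is the weight in the
  -- Christoffel bound.
  rw [← mul_prod_erase univ _ (mem_univ i)]
  simp only [w]
  rw [← mul_prod_erase univ _ (mem_univ i), ← mul_assoc]
  have he : ∏ j ∈ univ.erase i, (condBitPoly i j (y j)).eval p =
      ∏ j ∈ univ.erase i, if y j = 0 then 1 - p else p := by
    refine prod_congr rfl fun j hj => ?_
    rw [condBitPoly, if_neg (ne_of_mem_erase hj)]
    split_ifs <;> simp
  rw [he]
  refine mul_le_mul_of_nonneg_right ?_ (prod_nonneg fun j _ => by split_ifs <;> simp [hp.1, hp.2])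
  rw [condBitPoly, if_pos rfl]
  split_ifs <;> simp [hp.2]

/-! ### Powers of the kernel and lower bounds by eigenfunctions -/

theorem binaryBurnside_pow_succ_apply {n : ℕ} (s : ℕ) (x y : Fin n → ZMod 2) :
    (binaryBurnside n ^ (s + 1)) x y = ∑ z, binaryBurnside n x z * (binaryBurnside n ^ s) z y := by
  rw [pow_succ', Matrix.mul_apply]

theorem binaryBurnside_pow_reversible {n : ℕ} (s : ℕ) (x y : Fin n → ZMod 2) :
    binaryStationary n x * (binaryBurnside n ^ s) x y =
      binaryStationary n y * (binaryBurnside n ^ s) y x := by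
  induction s generalizing x y with
  | zero =>
    rw [pow_zero, Matrix.one_apply, Matrix.one_apply]
    by_cases h : x = y
    · rw [h]
    · rw [if_neg h, if_neg (Ne.symm h), mul_zero, mul_zero]
  | succ s ih =>
    rw [binaryBurnside_pow_succ_apply, pow_succ, Matrix.mul_apply, mul_sum, mul_sum]
    refine sum_congr rfl fun z _ => ?_
    rw [← mul_assoc, binaryBurnside_reversible, mul_right_comm, ih]
    ring

theorem sum_binaryBurnside_pow_of_eigen {n : ℕ} {f : (Fin n → ZMod 2) → ℝ} {a : ℝ}
    (hf : ∀ x, ∑ y, binaryBurnside n x y * f y = a * f x) (s : ℕ) (x : Fin n → ZMod 2) :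
    ∑ y, (binaryBurnside n ^ s) x y * f y = a ^ s * f x := by
  induction s generalizing x with
  | zero => simp [Matrix.one_apply]
  | succ s ih =>
    simp only [binaryBurnside_pow_succ_apply, sum_mul]
    rw [sum_comm]
    simp only [mul_assoc, ← mul_sum, ih]
    rw [sum_congr rfl fun z _ => mul_left_comm _ _ _, ← mul_sum, hf, pow_succ]
    ring

theorem sum_stationary_burnside {n : ℕ} (f : (Fin n → ZMod 2) → ℝ) :
    ∑ x, binaryStationary n x * ∑ y, binaryBurnside n x y * f y =
      ∑ y, binaryStationary n y * f y := by
  simp only [mul_sum, ← mul_assoc]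
  rw [sum_comm]
  simp only [binaryBurnside_reversible (n := n), ← sum_mul, ← mul_sum, binaryBurnside_row_sum,
    mul_one]

/-- Stationarity forces the correlation c to satisfy c = 1/4 + c/4. -/
theorem sum_stationary_pair {n : ℕ} {i j : Fin n} (hij : i ≠ j) :
    ∑ y, binaryStationary n y * (bitSign (y i) * bitSign (y j)) = 1 / 3 := by
  have h := sum_stationary_burnside (n := n) fun y => bitSign (y i) * bitSign (y j)
  simp only [binaryBurnside_sum_walsh_pair hij, mul_add, sum_add_distrib, ← sum_mul,
    sum_binaryStationary] at h
  simp only [mul_left_comm _ (1 / 4 : ℝ), ← mul_sum] at h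
  linarith

theorem sum_pow_sub_stationary_mul {n : ℕ} {f : (Fin n → ZMod 2) → ℝ} {a : ℝ}
    (hf : ∀ x, ∑ y, binaryBurnside n x y * f y = a * f x)
    (hmean : ∑ y, binaryStationary n y * f y = 0) (s : ℕ) (x : Fin n → ZMod 2) :
    ∑ y, ((binaryBurnside n ^ s) x y - binaryStationary n y) * f y = a ^ s * f x := by
  simp only [sub_mul, sum_sub_distrib, hmean, sum_binaryBurnside_pow_of_eigen hf, sub_zero]

theorem sq_eigen_le_binaryChiSquare {n : ℕ} {f : (Fin n → ZMod 2) → ℝ} {a : ℝ}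
    (hf : ∀ x, ∑ y, binaryBurnside n x y * f y = a * f x)
    (hmean : ∑ y, binaryStationary n y * f y = 0) (s : ℕ) (x : Fin n → ZMod 2) :
    (a ^ s * f x) ^ 2 ≤ binaryChiSquare n x s * ∑ y, binaryStationary n y * f y ^ 2 := by
  rw [← sum_pow_sub_stationary_mul hf hmean]
  refine sum_sq_le_sum_mul_sum_of_sq_le_mul _
    (fun y _ => div_nonneg (sq_nonneg _) (binaryStationary_pos y).le)
    (fun y _ => mul_nonneg (binaryStationary_pos y).le (sq_nonneg _)) fun y _ => le_of_eq ?_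
  have := (binaryStationary_pos y).ne'
  field_simp

theorem abs_eigen_le_binaryTV {n : ℕ} {f : (Fin n → ZMod 2) → ℝ} {a : ℝ}
    (hf : ∀ x, ∑ y, binaryBurnside n x y * f y = a * f x)
    (hmean : ∑ y, binaryStationary n y * f y = 0) {M : ℝ} (hM : ∀ y, |f y| ≤ M) (s : ℕ)
    (x : Fin n → ZMod 2) :
    |a ^ s * f x| ≤ 2 * binaryTV n x s * M := by
  rw [← sum_pow_sub_stationary_mul hf hmean]
  refine (abs_sum_le_sum_abs _ _).trans ?_
  rw [binaryTV, totalVariationDist, ← mul_assoc, mul_one_div_cancel two_ne_zero, one_mul, sum_mul]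
  refine sum_le_sum fun y _ => ?_
  rw [abs_mul]
  exact mul_le_mul_of_nonneg_left (hM y) (abs_nonneg _)

theorem sq_binaryTV_le {n : ℕ} (x : Fin n → ZMod 2) (s : ℕ) :
    4 * binaryTV n x s ^ 2 ≤ binaryChiSquare n x s := by
  have h := sum_sq_le_sum_mul_sum_of_sq_le_mul (univ : Finset (Fin n → ZMod 2))
    (r := fun y => |(binaryBurnside n ^ s) x y - binaryStationary n y|)
    (f := fun y => ((binaryBurnside n ^ s) x y - binaryStationary n y) ^ 2 / binaryStationary n y)
    (g := binaryStationary n)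
    (fun y _ => div_nonneg (sq_nonneg _) (binaryStationary_pos y).le)
    (fun y _ => (binaryStationary_pos y).le) fun y _ => by
      rw [div_mul_cancel₀ _ (binaryStationary_pos y).ne', sq_abs]
  rw [sum_binaryStationary, mul_one] at h
  refine le_trans (le_of_eq ?_) h
  rw [binaryTV, totalVariationDist]
  ring

theorem bitSign_singleOne_self {n : ℕ} (i : Fin n) : bitSign (singleOne i i) = -1 := by
  rw [singleOne, Pi.single_eq_same, bitSign_one]

theorem bitSign_singleOne_of_ne {n : ℕ} {i j : Fin n} (h : j ≠ i) :
    bitSign (singleOne i j) = 1 := by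
  rw [singleOne, Pi.single_eq_of_ne h, bitSign_zero]

theorem exists_two_ne {n : ℕ} (hn : 3 ≤ n) (i : Fin n) : ∃ j k : Fin n, i ≠ j ∧ i ≠ k ∧ j ≠ k := by
  have hcard : ∀ S : Finset (Fin n), #S < 3 → ∃ j, j ∉ S := by
    intro S hS
    by_contra! h
    have : #S = n := by rw [eq_univ_of_forall h, card_univ, Fintype.card_fin]
    omega
  obtain ⟨j, hj⟩ := hcard {i} (by simp)
  obtain ⟨k, hk⟩ := hcard {i, j} (card_le_two.trans_lt (by norm_num))
  simp only [mem_singleton, mem_insert, not_or] at hj hk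
  exact ⟨j, k, Ne.symm hj, Ne.symm hk.1, Ne.symm hk.2⟩

theorem binaryTV_lower {n : ℕ} (hn : 3 ≤ n) (i : Fin n) (s : ℕ) :
    1 / 2 * (1 / 4 : ℝ) ^ s ≤ binaryTV n (singleOne i) s := by
  obtain ⟨j, -, hij, -, -⟩ := exists_two_ne hn i
  -- A centered eigenfunction whose absolute value attains its maximum 4/3 at the starting state.
  set f : (Fin n → ZMod 2) → ℝ := fun y => bitSign (y i) * bitSign (y j) - 1 / 3
  have hf : ∀ x, ∑ y, binaryBurnside n x y * f y = 1 / 4 * f x := by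
    intro x
    simp only [f, mul_sub, sum_sub_distrib, ← sum_mul, binaryBurnside_row_sum,
      binaryBurnside_sum_walsh_pair hij]
    ring
  have hmean : ∑ y, binaryStationary n y * f y = 0 := by
    simp only [f, mul_sub, sum_sub_distrib, ← sum_mul, sum_binaryStationary,
      sum_stationary_pair hij]
    ring
  have hM : ∀ y, |f y| ≤ 4 / 3 := by
    intro y
    simp only [f, bitSign]
    split_ifs <;> norm_num [abs_le]
  have h := (neg_le_abs _).trans (abs_eigen_le_binaryTV hf hmean hM s (singleOne i))
  simp only [f, bitSign_singleOne_self, bitSign_singleOne_of_ne hij.symm] at h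
  linarith

theorem binaryChiSquare_lower {n : ℕ} (hn : 3 ≤ n) (i : Fin n) (s : ℕ) :
    5 * (1 / 4 : ℝ) ^ (2 * s) ≤ binaryChiSquare n (singleOne i) s := by
  obtain ⟨j, k, hij, hik, hjk⟩ := exists_two_ne hn i
  -- The signs align all terms at the starting state: the value there is -10/3 and the variance is
  -- 20/9, so the ratio (10/3)²/(20/9) is the constant 5.
  set f : (Fin n → ZMod 2) → ℝ := fun y => bitSign (y i) * bitSign (y j) +
    bitSign (y i) * bitSign (y k) - bitSign (y j) * bitSign (y k) - 1 / 3
  have hf : ∀ x, ∑ y, binaryBurnside n x y * f y = 1 / 4 * f x := by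
    intro x
    simp only [f, mul_sub, mul_add, sum_sub_distrib, sum_add_distrib, ← sum_mul,
      binaryBurnside_row_sum, binaryBurnside_sum_walsh_pair hij,
      binaryBurnside_sum_walsh_pair hik, binaryBurnside_sum_walsh_pair hjk]
    ring
  have hmean : ∑ y, binaryStationary n y * f y = 0 := by
    simp only [f, mul_sub, mul_add, sum_sub_distrib, sum_add_distrib, ← sum_mul,
      sum_binaryStationary, sum_stationary_pair hij, sum_stationary_pair hik,
      sum_stationary_pair hjk]
    ring
  have hvar : ∑ y, binaryStationary n y * f y ^ 2 = 20 / 9 := by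
    have hsq : ∀ y, f y ^ 2 = 28 / 9 + 8 / 3 * (bitSign (y j) * bitSign (y k)) -
        8 / 3 * (bitSign (y i) * bitSign (y k)) - 8 / 3 * (bitSign (y i) * bitSign (y j)) := by
      intro y
      simp only [f, bitSign]
      split_ifs <;> norm_num
    have h1 := sum_stationary_pair hij
    have h2 := sum_stationary_pair hik
    have h3 := sum_stationary_pair hjk
    simp only [hsq, mul_sub, mul_add, sum_sub_distrib, sum_add_distrib, ← sum_mul,
      sum_binaryStationary, mul_left_comm _ (8 / 3 : ℝ), ← mul_sum, h1, h2, h3]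
    norm_num
  have h := sq_eigen_le_binaryChiSquare hf hmean s (singleOne i)
  rw [hvar] at h
  simp only [f, bitSign_singleOne_self, bitSign_singleOne_of_ne hij.symm,
    bitSign_singleOne_of_ne hik.symm] at h
  rw [mul_pow, ← pow_mul, mul_comm s 2] at h
  linarith

/-! ### Symmetrization and the spectral upper bound -/

/-- The embedding of functions into Euclidean space that turns the norm of `L²(π)` into the
Euclidean norm. -/
noncomputable def stationaryEmbedding (n : ℕ) :
    ((Fin n → ZMod 2) → ℝ) →ₗ[ℝ] EuclideanSpace ℝ (Fin n → ZMod 2) where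
  toFun f := WithLp.toLp 2 fun y => √(binaryStationary n y) * f y
  map_add' f g := by ext y; simp [mul_add]
  map_smul' a f := by ext y; simp [mul_left_comm]

theorem stationaryEmbedding_apply {n : ℕ} (f : (Fin n → ZMod 2) → ℝ) (y : Fin n → ZMod 2) :
    stationaryEmbedding n f y = √(binaryStationary n y) * f y := rfl

theorem inner_stationaryEmbedding {n : ℕ} (f g : (Fin n → ZMod 2) → ℝ) :
    inner ℝ (stationaryEmbedding n f) (stationaryEmbedding n g) =
      ∑ y, binaryStationary n y * (f y * g y) := by
  rw [PiLp.inner_apply]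
  refine sum_congr rfl fun y _ => ?_
  rw [stationaryEmbedding_apply, stationaryEmbedding_apply, RCLike.inner_apply, conj_trivial]
  linear_combination (f y * g y) * Real.mul_self_sqrt (binaryStationary_pos y).le

/-- The operator on Euclidean space conjugate to the binary Burnside kernel. -/
noncomputable def symmetrizedBurnside (n : ℕ) :
    EuclideanSpace ℝ (Fin n → ZMod 2) →ₗ[ℝ] EuclideanSpace ℝ (Fin n → ZMod 2) where
  toFun v := stationaryEmbedding n
    ((binaryBurnside n).mulVec fun y => (√(binaryStationary n y))⁻¹ * v y)
  map_add' v w := by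
    rw [← map_add, ← Matrix.mulVec_add]
    congr 2
    ext y
    simp [mul_add]
  map_smul' a v := by
    rw [RingHom.id_apply, ← map_smul, ← Matrix.mulVec_smul]
    congr 2
    ext y
    simp [mul_left_comm]

theorem symmetrizedBurnside_embedding {n : ℕ} (f : (Fin n → ZMod 2) → ℝ) :
    symmetrizedBurnside n (stationaryEmbedding n f) =
      stationaryEmbedding n ((binaryBurnside n).mulVec f) := by
  change stationaryEmbedding n ((binaryBurnside n).mulVec fun y =>
    (√(binaryStationary n y))⁻¹ * stationaryEmbedding n f y) = _
  congr 2
  ext y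
  rw [stationaryEmbedding_apply, inv_mul_cancel_left₀ (Real.sqrt_pos.2 (binaryStationary_pos y)).ne']

theorem symmetrizedBurnside_pow_embedding {n : ℕ} (s : ℕ) (f : (Fin n → ZMod 2) → ℝ) :
    (symmetrizedBurnside n ^ s) (stationaryEmbedding n f) =
      stationaryEmbedding n ((binaryBurnside n ^ s).mulVec f) := by
  induction s with
  | zero => simp
  | succ s ih =>
    rw [pow_succ', Module.End.mul_apply, ih, symmetrizedBurnside_embedding, Matrix.mulVec_mulVec,
      pow_succ']

theorem stationaryEmbedding_surjective (n : ℕ) : Function.Surjective (stationaryEmbedding n) := by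
  intro v
  refine ⟨fun y => (√(binaryStationary n y))⁻¹ * v y, ?_⟩
  ext y
  rw [stationaryEmbedding_apply, mul_inv_cancel_left₀ (Real.sqrt_pos.2 (binaryStationary_pos y)).ne']

theorem symmetrizedBurnside_isSymmetric (n : ℕ) : (symmetrizedBurnside n).IsSymmetric := by
  intro v w
  obtain ⟨f, rfl⟩ := stationaryEmbedding_surjective n v
  obtain ⟨g, rfl⟩ := stationaryEmbedding_surjective n w
  rw [symmetrizedBurnside_embedding, symmetrizedBurnside_embedding, inner_stationaryEmbedding,
    inner_stationaryEmbedding]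
  simp only [Matrix.mulVec, dotProduct, sum_mul, mul_sum]
  rw [sum_comm]
  refine sum_congr rfl fun y _ => sum_congr rfl fun x _ => ?_
  linear_combination (f y * g x) * binaryBurnside_reversible x y

theorem binaryChiSquare_le_sum {n : ℕ} (i : Fin n) (s : ℕ) :
    binaryChiSquare n (singleOne i) s ≤ ∑ m ∈ range n, burnsideEigenvalue (m + 1) ^ (2 * s) *
      ((((m + 1 : ℕ) + 1) * ((m + 1 : ℕ) + 2)) ^ 2 / 2) := by
  set x : Fin n → ZMod 2 := singleOne i
  -- The density of the point mass at x with respect to π. Pairing with it in L²(π) evaluates at x,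
  -- its projection to the constants is 1, and by reversibility the kernel powers map it to the
  -- density of the law after s steps.
  set δ : (Fin n → ZMod 2) → ℝ := Pi.single x (binaryStationary n x)⁻¹
  have hπ := (binaryStationary_pos x).ne'
  have hδ : ∀ f, inner ℝ (stationaryEmbedding n f) (stationaryEmbedding n δ) = f x := by
    intro f
    rw [inner_stationaryEmbedding, sum_eq_single x]
    · simp only [δ, Pi.single_eq_same]
      field_simp
    · intro y _ hy
      simp [δ, Pi.single_eq_of_ne hy]
    · simp
  have hnorm : ∀ f, ‖stationaryEmbedding n f‖ ^ 2 = ∑ y, binaryStationary n y * f y ^ 2 := by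
    intro f
    rw [← real_inner_self_eq_norm_sq, inner_stationaryEmbedding]
    simp only [pow_two]
  set V : ℕ → Submodule ℝ (EuclideanSpace ℝ (Fin n → ZMod 2)) :=
    fun m => (walshSpan n m).map (stationaryEmbedding n)
  have hμ0 : burnsideEigenvalue 0 = 1 := by
    simpa using burnsideEigenvalue_two_mul 0
  have hconst : ∀ a : ℝ, (binaryBurnside n).mulVec (fun _ => a) = fun _ => a := by
    intro a
    ext z
    simp only [Matrix.mulVec, dotProduct, ← sum_mul, binaryBurnside_row_sum, one_mul]
  have hproj : (V 0).starProjection (stationaryEmbedding n δ) =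
      stationaryEmbedding n (fun _ => 1) := by
    refine Submodule.eq_starProjection_of_mem_of_inner_eq_zero ?_ ?_
    · refine ⟨_, ?_, rfl⟩
      have h1 : walsh ∅ = fun _ : Fin n → ZMod 2 => (1 : ℝ) := _root_.funext walsh_empty
      rw [← h1]
      exact walsh_mem_walshSpan (by simp)
    · rintro _ ⟨f, hf, rfl⟩
      obtain ⟨a, rfl⟩ := eq_const_of_mem_walshSpan_zero hf
      rw [real_inner_comm, inner_sub_right, hδ, inner_stationaryEmbedding, ← sum_mul,
        sum_binaryStationary]
      ring
  have h := norm_sq_pow_sub_le (symmetrizedBurnside_isSymmetric n) (V := V)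
    (fun a b hab => Submodule.map_mono (walshSpan_mono n hab)) (μ := burnsideEigenvalue)
    (v := stationaryEmbedding n δ) (Λ := fun m : ℕ => ((m + 1) * (m + 2)) ^ 2 / 2) (n := n)
    (by
      rintro _ ⟨f, hf, rfl⟩
      obtain ⟨a, rfl⟩ := eq_const_of_mem_walshSpan_zero hf
      rw [symmetrizedBurnside_embedding, hconst, hμ0, one_smul])
    (by
      rintro m _ ⟨f, hf, rfl⟩
      rw [symmetrizedBurnside_embedding, ← map_smul, ← map_sub]
      exact ⟨_, binaryBurnside_sub_mem_walshSpan hf, rfl⟩)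
    (fun m => by positivity)
    (by
      rintro m _ ⟨f, hf, rfl⟩
      rw [hδ, hnorm]
      exact sq_apply_singleOne_le i hf)
    ⟨δ, single_mem_walshSpan x _, rfl⟩ s
  refine le_trans (le_of_eq ?_) h
  rw [hproj, hμ0, one_pow, one_smul, symmetrizedBurnside_pow_embedding, ← map_sub, hnorm,
    binaryChiSquare, chiSquareDist]
  refine sum_congr rfl fun y _ => ?_
  have hy := (binaryStationary_pos y).ne'
  have hmul : (binaryBurnside n ^ s).mulVec δ y =
      (binaryBurnside n ^ s) x y / binaryStationary n y := by
    simp only [δ, Matrix.mulVec_single]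
    have := binaryBurnside_pow_reversible s y x
    simp
    field_simp
    linarith
  rw [Pi.sub_apply, hmul]
  field_simp

/-! ### Summing the spectral bound -/

/-- The induction closes because (2k+1)²(3k+4) and (2k+2)²(3k+1) differ only by k. Equality at k = 1
keeps the exact rate 1/4. -/
theorem sq_centralBinom_div_le (k : ℕ) :
    ((k.centralBinom : ℝ) / 4 ^ k) ^ 2 ≤ 1 / (3 * k + 1) := by
  induction k with
  | zero => simp
  | succ k ih =>
    have h : ((k : ℝ) + 1) * (k + 1).centralBinom = 2 * (2 * k + 1) * k.centralBinom := by
      exact_mod_cast Nat.succ_mul_centralBinom_succ k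
    have h' : ((k + 1).centralBinom : ℝ) / 4 ^ (k + 1) =
        (2 * k + 1) / (2 * k + 2) * (k.centralBinom / 4 ^ k) := by
      rw [pow_succ]
      field_simp
      linear_combination 2 * h
    rw [h', mul_pow]
    refine (mul_le_mul_of_nonneg_left ih (sq_nonneg _)).trans ?_
    push_cast
    rw [div_pow, div_mul_div_comm, div_le_div_iff₀ (by positivity) (by positivity)]
    have : (0 : ℝ) ≤ k := k.cast_nonneg
    nlinarith

theorem burnsideEigenvalue_term_le {s : ℕ} (hs : 3 ≤ s) (k : ℕ) :
    burnsideEigenvalue (2 * (k + 1)) ^ (2 * s) *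
      (((2 * (k + 1) : ℕ) + 1) * ((2 * (k + 1) : ℕ) + 2)) ^ 2 / 2 ≤
      270 * (1 / 4 : ℝ) ^ (2 * s) * (1 / (k + 1) - 1 / (k + 2)) := by
  rw [burnsideEigenvalue_two_mul]
  set b : ℝ := (((k + 1).centralBinom : ℝ) / 4 ^ (k + 1)) ^ 2
  have hb0 : 0 ≤ b := sq_nonneg _
  have hk : (0 : ℝ) ≤ k := k.cast_nonneg
  have hb : b ≤ 1 / (3 * k + 4) := by
    refine (sq_centralBinom_div_le (k + 1)).trans_eq ?_
    push_cast
    ring_nf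
  have hb4 : b ≤ 1 / 4 := hb.trans (one_div_le_one_div_of_le (by norm_num) (by linarith))
  obtain ⟨t, rfl⟩ := Nat.exists_eq_add_of_le hs
  -- Six of the 2s factors, available as s ≥ 3, supply decay k⁻⁶ against the quartic evaluation
  -- bound; the others are bounded by 1/4 each.
  have h1 : b ^ (2 * (3 + t)) ≤ (1 / (3 * k + 4)) ^ 6 * (1 / 4) ^ (2 * t) := by
    rw [show 2 * (3 + t) = 6 + 2 * t by ring, pow_add]
    gcongr
  have h2 : (1 / (3 * (k : ℝ) + 4)) ^ 6 *
      (((2 * (k + 1) : ℕ) + 1) * ((2 * (k + 1) : ℕ) + 2)) ^ 2 / 2 ≤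
      270 * (1 / 4) ^ 6 * (1 / (k + 1) - 1 / (k + 2)) := by
    have e : (1 / ((k : ℝ) + 1) - 1 / (k + 2)) = 1 / ((k + 1) * (k + 2)) := by
      field_simp
      ring
    rw [e, one_div_pow, one_div_mul_eq_div, div_div, one_div_pow, mul_one_div, mul_one_div, div_div,
      div_le_div_iff₀ (by positivity) (by positivity), ← sub_nonneg]
    push_cast
    ring_nf
    positivity
  calc _ ≤ (1 / (3 * (k : ℝ) + 4)) ^ 6 * (1 / 4) ^ (2 * t) *
        (((2 * (k + 1) : ℕ) + 1) * ((2 * (k + 1) : ℕ) + 2)) ^ 2 / 2 := by gcongr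
    _ = (1 / 4) ^ (2 * t) * ((1 / (3 * (k : ℝ) + 4)) ^ 6 *
        (((2 * (k + 1) : ℕ) + 1) * ((2 * (k + 1) : ℕ) + 2)) ^ 2 / 2) := by ring
    _ ≤ (1 / 4) ^ (2 * t) * (270 * (1 / 4) ^ 6 * (1 / (k + 1) - 1 / (k + 2))) := by gcongr
    _ = _ := by rw [show 2 * (3 + t) = 6 + 2 * t by ring, pow_add]; ring

theorem binaryChiSquare_upper {n : ℕ} (i : Fin n) {s : ℕ} (hs : 3 ≤ s) :
    binaryChiSquare n (singleOne i) s ≤ 270 * (1 / 4 : ℝ) ^ (2 * s) := by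
  refine (binaryChiSquare_le_sum i s).trans ?_
  have hpos : 0 ≤ 270 * (1 / 4 : ℝ) ^ (2 * s) := by positivity
  -- The bounds 1/(k+1) - 1/(k+2) telescope over even degrees, and odd degrees contribute nothing,
  -- hence the n / 2.
  have h : ∀ n : ℕ, ∑ m ∈ range n, burnsideEigenvalue (m + 1) ^ (2 * s) *
      ((((m + 1 : ℕ) + 1) * ((m + 1 : ℕ) + 2)) ^ 2 / 2) ≤
      270 * (1 / 4 : ℝ) ^ (2 * s) * (1 - 1 / ((n / 2 : ℕ) + 1)) := by
    intro n
    induction n with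
    | zero => simp
    | succ n ih =>
      rw [sum_range_succ]
      rcases Nat.even_or_odd' n with ⟨k, rfl | rfl⟩
      · rw [burnsideEigenvalue_odd ⟨k, rfl⟩, zero_pow (by omega), zero_mul, add_zero]
        rwa [show (2 * k + 1) / 2 = 2 * k / 2 by omega]
      · have h1 := burnsideEigenvalue_term_le hs k
        rw [show (2 * k + 1) / 2 = k by omega] at ih
        rw [show (2 * k + 1 + 1) / 2 = k + 1 by omega, show 2 * k + 1 + 1 = 2 * (k + 1) by ring,
          ← mul_div_assoc]
        refine (add_le_add ih h1).trans (le_of_eq ?_)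
        push_cast
        ring
  refine (h n).trans (mul_le_of_le_one_right hpos ?_)
  rw [sub_le_self_iff]
  positivity

theorem theorem5p7 :
    -- the two-sided bound on the chi-square distance
    (∀ n s : ℕ, 3 ≤ n → 3 ≤ s → ∀ i : Fin n,
      5 * (1 / 4 : ℝ) ^ (2 * s) ≤ binaryChiSquare n (singleOne i) s ∧
      binaryChiSquare n (singleOne i) s ≤ 270 * (1 / 4 : ℝ) ^ (2 * s)) ∧
    -- a number of steps that does not depend on `n` suffices
    (∀ ε : ℝ, 0 < ε → ∃ s₀ : ℕ, ∀ n : ℕ, 3 ≤ n → ∀ i : Fin n, ∀ s : ℕ, s₀ ≤ s →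
      binaryChiSquare n (singleOne i) s ≤ ε ∧ binaryTV n (singleOne i) s ≤ ε) ∧
    -- and is necessary: after boundedly many steps the distances are bounded below
    (∀ s₀ : ℕ, ∃ ε : ℝ, 0 < ε ∧ ∀ n : ℕ, 3 ≤ n → ∀ i : Fin n, ∀ s : ℕ, s ≤ s₀ →
      ε ≤ binaryChiSquare n (singleOne i) s ∧ ε ≤ binaryTV n (singleOne i) s) := by
  refine ⟨fun n s hn hs i => ⟨binaryChiSquare_lower hn i s, binaryChiSquare_upper i hs⟩, ?_, ?_⟩
  · intro ε hε
    -- The second entry of the minimum serves total variation, through 4 TV² ≤ χ².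
    obtain ⟨s₁, hs₁⟩ := exists_pow_lt_of_lt_one
      (show 0 < min ε (4 * ε ^ 2) / 270 by positivity) (show (1 / 4 : ℝ) < 1 by norm_num)
    refine ⟨max 3 s₁, fun n _ i s hs => ?_⟩
    have hpow : 270 * (1 / 4 : ℝ) ^ (2 * s) ≤ min ε (4 * ε ^ 2) := by
      have h1 : (1 / 4 : ℝ) ^ (2 * s) ≤ (1 / 4) ^ s₁ :=
        pow_le_pow_of_le_one (by norm_num) (by norm_num)
          (((le_max_right 3 s₁).trans hs).trans (by omega))
      rw [lt_div_iff₀ (by norm_num)] at hs₁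
      linarith
    have hχ := (binaryChiSquare_upper i ((le_max_left 3 s₁).trans hs)).trans hpow
    refine ⟨hχ.trans (min_le_left _ _), ?_⟩
    have h4 := (sq_binaryTV_le (singleOne i) s).trans (hχ.trans (min_le_right _ _))
    exact le_of_sq_le_sq (by linarith) hε.le
  · intro s₀
    -- One ε for both distances: it lies below 5 (1/4)^(2s) and below (1/2) (1/4)^s for every s ≤
    -- s₀.
    refine ⟨1 / 2 * (1 / 4 : ℝ) ^ (2 * s₀), by positivity, fun n hn i s hs => ⟨?_, ?_⟩⟩
    · have h1 : (1 / 4 : ℝ) ^ (2 * s₀) ≤ (1 / 4) ^ (2 * s) :=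
        pow_le_pow_of_le_one (by norm_num) (by norm_num) (by omega)
      have h2 : (0 : ℝ) < (1 / 4) ^ (2 * s) := by positivity
      linarith [binaryChiSquare_lower hn i s]
    · have h1 : (1 / 4 : ℝ) ^ (2 * s₀) ≤ (1 / 4) ^ s :=
        pow_le_pow_of_le_one (by norm_num) (by norm_num) (by omega)
      linarith [binaryTV_lower hn i s]
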